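/- **Definitions.** A topologically sorted circuit $C$ of size $s$ is a list of triples $(\ell_i, r_i, \varphi_i)$, $0 \le i < s$, where $\varphi_i : \{0,1\}^2 \to \{0,1\}$ is an arbitrary function and each of $\ell_i, r_i$ is either the index $j < i$ of an earlier gate or a constant bit. Gate $i$ has the value $\varphi_i$ applied to the two bits that $\ell_i$ and $r_i$ refer to; the output of $C$ is the value of its last gate $s-1$. A $\mathrm{TreeEval}$ instance of arity $d$, height $h$ and value size $b$ is the full $d$-ary tree of height $h$ in which each leaf $u \in \{0,\dots,d-1\}^h$ is labeled with a value $v_u \in \{0,1\}^b$ and each internal node $u \in \{0,\dots,d-1\}^{<h}$ with a function $f_u : (\{0,1\}^b)^d \to \{0,1\}^b$; the values of the internal nodes are $v_u := f_u(v_{u0}, \dots, v_{u(d-1)})$. For a leaf $u$, let $f_u$ denote the constant function with value $v_u$. Space is the space of a random access machine with read-only input and write-only output: the maximum, over the configurations in its computation, of the total number of bits of the addresses and contents of its nonzero registers. **Theorem.** Given a topologically sorted circuit $C$ of size $s$ and any integer $b \in [2, s]$, one can produce an equivalent $\mathrm{TreeEval}$ instance of arity $2$, value size $b$ and height $h = O(s/b)$,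 where $h$ depends only on $s$ and $b$. Equivalent means that the output of $C$ is bit number $s \bmod b$ (counting from $0$) of the root value. The reduction is locally computable in space $O(b + \log s)$: there is one procedure that, on input $(C, b, u, x, y)$ with $u \in \{0,1\}^{\le h}$ a node of the tree and $x, y \in \{0,1\}^b$, computes $f_u(x, y)$ in space $O(b + \log s)$, and one that computes $h$ from $(s, b)$ in space $O(b + \log s)$. The procedures and the constants in the $O(\cdot)$ are the same for all $s$, $b$, $C$, $u$, $x$, $y$. -/

import Mathlib

/-! ### Circuits -/

/-- An input wire of gate number `i` in a topologically sorted circuit: either an earlier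
gate `j < i` or a constant bit. -/
inductive Wire (i : ℕ) where
  | gate (j : Fin i)
  | const (v : Bool)

/-- Gate number `i`: a triple `(ℓ, r, φ)` with `φ : {0,1}² → {0,1}` an arbitrary function. -/
structure Gate (i : ℕ) where
  left : Wire i
  right : Wire i
  op : Bool → Bool → Bool

/-- A topologically sorted circuit with gates `0, …, s - 1` over the full binary basis. -/
def Circuit (s : ℕ) : Type := (i : Fin s) → Gate i.val

/-- The bit carried by a wire, given the values of the earlier gates. -/
def Wire.val {i : ℕ} (g : Fin i → Bool) : Wire i → Bool
  | .gate j => g j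
  | .const v => v

/-- The value of gate `i`. -/
def Circuit.val {s : ℕ} (C : Circuit s) (i : Fin s) : Bool :=
  (C i).op ((C i).left.val fun j => C.val ⟨j.val, j.isLt.trans i.isLt⟩)
    ((C i).right.val fun j => C.val ⟨j.val, j.isLt.trans i.isLt⟩)
termination_by i.val
decreasing_by all_goals exact j.isLt

/-- The output of a nonempty circuit: the value of its last gate. -/
def Circuit.output {s : ℕ} (C : Circuit s) (hs : 0 < s) : Bool :=
  C.val ⟨s - 1, Nat.sub_lt hs Nat.one_pos⟩

/-! ### Tree evaluation -/

/-- A tree evaluation instance: the full `d`-ary tree of height `h` and value size `b`. A node is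
the list of child indices on the path from the root to it. Each leaf (a node of depth `h`) carries
a `b`-bit value and each internal node (of depth `< h`) a function of `d` values of `b` bits. -/
structure TreeEval (d h b : ℕ) where
  leaf : (u : List (Fin d)) → u.length = h → (Fin b → Bool)
  node : (u : List (Fin d)) → u.length < h → (Fin d → Fin b → Bool) → (Fin b → Bool)

namespace TreeEval

variable {d h b : ℕ}

/-- The function `f_u` at a node `u` of depth at most `h`; at a leaf it is the constant function
whose value is the label of that leaf. -/
def fn (T : TreeEval d h b) (u : List (Fin d)) (hu : u.length ≤ h)
    (z : Fin d → Fin b → Bool) : Fin b → Bool :=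
  if hl : u.length = h then T.leaf u hl else T.node u (lt_of_le_of_ne hu hl) z

/-- The value of the node `u`: the label of `u` if `u` is a leaf, and otherwise
`f_u (v_{u0}, …, v_{u(d-1)})`. -/
def val (T : TreeEval d h b) (u : List (Fin d)) (hu : u.length ≤ h) : Fin b → Bool :=
  if hl : u.length = h then T.leaf u hl
  else T.node u (lt_of_le_of_ne hu hl) fun i =>
    T.val (u ++ [i]) (by rw [List.length_append, List.length_singleton]; omega)
termination_by h - u.length
decreasing_by rw [List.length_append, List.length_singleton]; omega

/-- The value of the root. -/
def rootVal (T : TreeEval d h b) : Fin b → Bool := T.val [] (Nat.zero_le h)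

end TreeEval

/-! ### Random access machines and space

A random access machine has registers `0, 1, 2, …` that hold natural numbers, a read-only input
array of natural numbers with random access, and a write-only output. Space is measured
logarithmically: a configuration is charged, for each nonzero register, the number of bits of the
register's address plus the number of bits of its content. Input and output are not charged. -/

/-- Instructions; `r`, `a`, `c` are fixed register addresses, `n` a constant, `l` a program line. -/
inductive RAMInstr where
  /-- `R[r] := n` -/
  | const (r n : ℕ)
  /-- `R[r] := R[a] + R[c]` -/
  | add (r a c : ℕ)
  /-- `R[r] := max (R[a] - R[c]) 0` -/
  | sub (r a c : ℕ)
  /-- `R[r] := R[a] * R[c]` -/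
  | mul (r a c : ℕ)
  /-- `R[r] := ⌊R[a] / R[c]⌋`, which is `0` if `R[c] = 0` -/
  | div (r a c : ℕ)
  /-- `R[r] := R[R[a]]` -/
  | load (r a : ℕ)
  /-- `R[R[r]] := R[a]` -/
  | store (r a : ℕ)
  /-- `R[r] :=` entry number `R[a]` of the input array, which is `0` beyond its end -/
  | read (r a : ℕ)
  /-- append `R[a]` to the output -/
  | write (a : ℕ)
  /-- go to line `l` -/
  | jump (l : ℕ)
  /-- go to line `l` if `R[r] = 0` -/
  | jzero (r l : ℕ)
  /-- stop -/
  | halt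

/-- A configuration: current line, register contents, output written so far. -/
structure RAMCfg where
  pc : ℕ
  reg : ℕ →₀ ℕ
  out : List ℕ

namespace RAMCfg

/-- The logarithmic space of a configuration. -/
def space (c : RAMCfg) : ℕ := c.reg.sum fun a v => Nat.size a + Nat.size v

/-- Set register `r` to `v` and go to the next line. -/
noncomputable def set (c : RAMCfg) (r v : ℕ) : RAMCfg :=
  { c with pc := c.pc + 1, reg := c.reg.update r v }

/-- The initial configuration: line `0`, all registers zero, nothing written. -/
def init : RAMCfg := ⟨0, 0, []⟩

/-- Execute one instruction on the input array `I`. -/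
noncomputable def exec (I : List ℕ) (c : RAMCfg) : RAMInstr → Option RAMCfg
  | .const r n => some (c.set r n)
  | .add r a d => some (c.set r (c.reg a + c.reg d))
  | .sub r a d => some (c.set r (c.reg a - c.reg d))
  | .mul r a d => some (c.set r (c.reg a * c.reg d))
  | .div r a d => some (c.set r (c.reg a / c.reg d))
  | .load r a => some (c.set r (c.reg (c.reg a)))
  | .store r a => some (c.set (c.reg r) (c.reg a))
  | .read r a => some (c.set r (I.getD (c.reg a) 0))
  | .write a => some { c with pc := c.pc + 1, out := c.out ++ [c.reg a] }
  | .jump l => some { c with pc := l }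
  | .jzero r l => some { c with pc := if c.reg r = 0 then l else c.pc + 1 }
  | .halt => none

end RAMCfg

/-- One step of the program `P` on the input array `I`; the machine also stops when the current
line does not exist. -/
noncomputable def ramStep (P : List RAMInstr) (I : List ℕ) (c : RAMCfg) : Option RAMCfg :=
  P[c.pc]?.bind (c.exec I)

/-- Started on the input array `I`, the program `P` halts with output `O`, and every configuration
in the computation has space at most `S`. -/
def RAMComputesInSpace (P : List RAMInstr) (I O : List ℕ) (S : ℕ) : Prop :=
  (∃ c ∈ StateTransition.eval (ramStep P I) RAMCfg.init, c.out = O) ∧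
    ∀ c, StateTransition.Reaches (ramStep P I) RAMCfg.init c → c.space ≤ S

/-! ### The input array `(C, b, u, x, y)` -/

/-- A bit string as a list of numbers `0`, `1`. -/
def bitList {b : ℕ} (x : Fin b → Bool) : List ℕ := List.ofFn fun i => (x i).toNat

/-- Constants `0`, `1` are encoded by `0`, `1`, and gate `j` by `j + 2`. -/
def Wire.code {i : ℕ} : Wire i → ℕ
  | .gate j => j.val + 2
  | .const v => v.toNat

/-- The truth table of a binary function as a number in `{0, …, 15}`. -/
def opCode (f : Bool → Bool → Bool) : ℕ :=
  (f false false).toNat + 2 * (f false true).toNat + 4 * (f true false).toNat +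
    8 * (f true true).toNat

/-- The list of the triples `(ℓ_i, r_i, φ_i)`. -/
def Circuit.code {s : ℕ} (C : Circuit s) : List ℕ :=
  (List.finRange s).flatMap fun i => [(C i).left.code, (C i).right.code, opCode (C i).op]

/-- The input array for `(C, b, u, x, y)`: a header with the numbers `s`, `b`, `|u|`, followed by
the circuit, the node `u`, and the bit strings `x` and `y`. -/
def localInput {s b : ℕ} (C : Circuit s) (u : List (Fin 2)) (x y : Fin b → Bool) : List ℕ :=
  [s, b, u.length] ++ C.code ++ u.map Fin.val ++ bitList x ++ bitList y

/-!
Number the positions of the circuit so that gate `i` has position `i + 1` and position `0` is void,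
and cut the positions into blocks of length `b`. The output gate then has position `s`, which is
position `s % b` of block `s / b`.

**The tree.** A node of the form `block m` has the values of all gates of block `m` as its value. To
compute them one needs, besides the circuit, the bits on those left and right input wires of the
gates of the block that come from earlier blocks; these are two strings of `b` bits, and they are
the values of the two children `wires false m m` and `wires true m m`. A node `wires t m k` provides
the bits on the side-`t` wires of block `m` as far as they come from the blocks below `k`. Those
from the blocks below `k - 1` are the value of its left child `wires t m (k - 1)`, and the others
can be picked from the value of its right child `block (k - 1)`, whatever their number. So `k` drops
by one every two levels, and after `2 * (s / b) + 1` levels only nodes of the form `wires t m 0` are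
left, at which nothing is required (`Circuit.rank_nodeAt`). Correctness is `Circuit.valid_nodeFn`
at a single node and `Circuit.tree_rootVal` at the root. The function at a node depends only on its
description `block m` or `wires t m k`, which is found by following the path from the root with
three numbers of size at most `s` in memory.

**The space bound.** Programs are written in a small structured language (`RAMExp`, `RAMCmd`) with
a fixed number of variables, and reasoned about through weakest preconditions (`RAMCmd.wp`) that
also demand that all values stay below a bound `B`. The compiled code
(`RAMCmd.compile_correct`) uses a fixed number of registers, so that `B = 2 ^ K` means space `O(K)`
(`RAMCmd.computesInSpace`), and `K = b + log s + 8` is enough: indices into the input array are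
`O(s)`, the strings `x` and `y` are read from the input array when they are needed, and the bits of
the current block, which later gates of the same block refer to, are packed into a single number
below `2 ^ b` (`Circuit.blockAcc`). Packing matters, as `b` separate registers would cost
`b * log b` bits for their addresses. The program for the local functions is `nodeCmd`; its
correctness is `wp_nodeCmd`.
-/

/-! ### A structured language for random access machines -/

/-- Arithmetic expressions over `n` program variables, with access to the input array. -/
inductive RAMExp (n : ℕ) where
  | var (r : Fin n)
  | lit (k : ℕ)
  | add (e f : RAMExp n)
  | sub (e f : RAMExp n)
  | mul (e f : RAMExp n)
  | div (e f : RAMExp n)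
  | read (e : RAMExp n)

/-- Structured programs over `n` variables: assignments, output, sequencing, a conditional on an
expression being zero, and a loop that runs while an expression is nonzero. -/
inductive RAMCmd (n : ℕ) where
  | skip
  | assign (r : Fin n) (e : RAMExp n)
  | write (e : RAMExp n)
  | seq (c d : RAMCmd n)
  | ifz (e : RAMExp n) (c d : RAMCmd n)
  | loop (e : RAMExp n) (c : RAMCmd n)

/-- The state of a structured program: the values of its variables and the output so far. -/
structure RAMState (n : ℕ) where
  reg : Fin n → ℕ
  out : List ℕ

namespace RAMState

variable {n : ℕ}

/-- Assign the value `v` to the variable `r`. -/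
def set (σ : RAMState n) (r : Fin n) (v : ℕ) : RAMState n :=
  { σ with reg := Function.update σ.reg r v }

/-- Append `v` to the output. -/
def emit (σ : RAMState n) (v : ℕ) : RAMState n := { σ with out := σ.out ++ [v] }

theorem set_reg (σ : RAMState n) (r q : Fin n) (v : ℕ) :
    (σ.set r v).reg q = if q = r then v else σ.reg q := by
  simp [set, Function.update_apply]

theorem set_out (σ : RAMState n) (r : Fin n) (v : ℕ) : (σ.set r v).out = σ.out := rfl

theorem emit_reg (σ : RAMState n) (v : ℕ) : (σ.emit v).reg = σ.reg := rfl

end RAMState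

namespace RAMExp

variable {n : ℕ}

/-- The value of an expression on the input array `I`. -/
def eval (I : List ℕ) (σ : RAMState n) : RAMExp n → ℕ
  | var r => σ.reg r
  | lit k => k
  | add e f => e.eval I σ + f.eval I σ
  | sub e f => e.eval I σ - f.eval I σ
  | mul e f => e.eval I σ * f.eval I σ
  | div e f => e.eval I σ / f.eval I σ
  | read e => I.getD (e.eval I σ) 0

/-- The value of the expression and of each of its subexpressions is less than `B`. -/
def Bounded (I : List ℕ) (B : ℕ) (σ : RAMState n) : RAMExp n → Prop
  | var r => σ.reg r < B
  | lit k => k < B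
  | add e f => e.Bounded I B σ ∧ f.Bounded I B σ ∧ e.eval I σ + f.eval I σ < B
  | sub e f => e.Bounded I B σ ∧ f.Bounded I B σ
  | mul e f => e.Bounded I B σ ∧ f.Bounded I B σ ∧ e.eval I σ * f.eval I σ < B
  | div e f => e.Bounded I B σ ∧ f.Bounded I B σ
  | read e => e.Bounded I B σ ∧ I.getD (e.eval I σ) 0 < B

/-- The number of scratch registers used in evaluating an expression. -/
def temps : RAMExp n → ℕ
  | var _ => 1
  | lit _ => 1
  | add e f => max e.temps (f.temps + 1)
  | sub e f => max e.temps (f.temps + 1)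
  | mul e f => max e.temps (f.temps + 1)
  | div e f => max e.temps (f.temps + 1)
  | read e => e.temps

/-- Code that leaves the value of an expression in register `t` and changes no register below
`t`. -/
def compile (t : ℕ) : RAMExp n → List RAMInstr
  | var r => [.const t 0, .add t r t]
  | lit k => [.const t k]
  | add e f => e.compile t ++ f.compile (t + 1) ++ [.add t t (t + 1)]
  | sub e f => e.compile t ++ f.compile (t + 1) ++ [.sub t t (t + 1)]
  | mul e f => e.compile t ++ f.compile (t + 1) ++ [.mul t t (t + 1)]
  | div e f => e.compile t ++ f.compile (t + 1) ++ [.div t t (t + 1)]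
  | read e => e.compile t ++ [.read t t]

theorem temps_pos (e : RAMExp n) : 0 < e.temps := by
  induction e <;> simp [temps, *]

theorem Bounded.eval_lt {I : List ℕ} {B : ℕ} {σ : RAMState n} {e : RAMExp n}
    (h : e.Bounded I B σ) : e.eval I σ < B := by
  induction e with
  | var r => exact h
  | lit k => exact h
  | add e f => exact h.2.2
  | sub e f he hf => exact (Nat.sub_le _ _).trans_lt (he h.1)
  | mul e f => exact h.2.2
  | div e f he hf => exact (Nat.div_le_self _ _).trans_lt (he h.1)
  | read e => exact h.2

end RAMExp

namespace RAMCmd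

variable {n : ℕ}

/-- The number of scratch registers used by a structured program. -/
def temps : RAMCmd n → ℕ
  | skip => 0
  | assign _ e => e.temps
  | write e => e.temps
  | seq c d => max c.temps d.temps
  | ifz e c d => max e.temps (max c.temps d.temps)
  | .loop e c => max e.temps c.temps

/-- The number of instructions of the compiled program. -/
def size : RAMCmd n → ℕ
  | skip => 0
  | assign _ e => (e.compile n).length + 2
  | write e => (e.compile n).length + 1
  | seq c d => c.size + d.size
  | ifz e c d => (e.compile n).length + 1 + d.size + 1 + c.size
  | .loop e c => (e.compile n).length + 1 + c.size + 1

/-- The machine code of a structured program, to be placed at line `p`. Variable `r` is kept in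
register `r`, and the registers from `n` on serve as scratch space. An assignment moves the value
from register `n` to register `r` by clearing `r` and adding. -/
def compile : RAMCmd n → ℕ → List RAMInstr
  | skip, _ => []
  | assign r e, _ => e.compile n ++ [.const r 0, .add r n r]
  | write e, _ => e.compile n ++ [.write n]
  | seq c d, p => c.compile p ++ d.compile (p + c.size)
  | ifz e c d, p =>
      let q := p + (e.compile n).length + 1
      e.compile n ++ [.jzero n (q + d.size + 1)] ++ d.compile q ++
        [.jump (q + d.size + 1 + c.size)] ++ c.compile (q + d.size + 1)
  | .loop e c, p =>
      let q := p + (e.compile n).length + 1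
      e.compile n ++ [.jzero n (q + c.size + 1)] ++ c.compile q ++ [.jump p]

theorem length_compile (c : RAMCmd n) (p : ℕ) : (c.compile p).length = c.size := by
  induction c generalizing p <;> simp_all [compile, size] <;> omega

/-- The weakest precondition: started in the state `σ` on the input array `I`, the program halts
in a state satisfying `Q`, and all values that occur in the computation are less than `B`. For a
loop, `k` is the number of its iterations. -/
def wp (I : List ℕ) (B : ℕ) : RAMCmd n → (RAMState n → Prop) → RAMState n → Prop
  | skip, Q => Q
  | assign r e, Q => fun σ => e.Bounded I B σ ∧ Q (σ.set r (e.eval I σ))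
  | write e, Q => fun σ => e.Bounded I B σ ∧ Q (σ.emit (e.eval I σ))
  | seq c d, Q => c.wp I B (d.wp I B Q)
  | ifz e c d, Q => fun σ =>
      e.Bounded I B σ ∧ if e.eval I σ = 0 then c.wp I B Q σ else d.wp I B Q σ
  | .loop e c, Q => fun σ => ∃ k : ℕ,
      Nat.rec (motive := fun _ => RAMState n → Prop)
        (fun σ => e.Bounded I B σ ∧ e.eval I σ = 0 ∧ Q σ)
        (fun _ W σ => e.Bounded I B σ ∧ e.eval I σ ≠ 0 ∧ c.wp I B W σ) k σ

theorem wp_mono {I : List ℕ} {B : ℕ} (c : RAMCmd n) {Q Q' : RAMState n → Prop}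
    (h : ∀ σ, Q σ → Q' σ) : ∀ σ, c.wp I B Q σ → c.wp I B Q' σ := by
  induction c generalizing Q Q' with
  | skip => exact h
  | assign r e => exact fun σ hσ => ⟨hσ.1, h _ hσ.2⟩
  | write e => exact fun σ hσ => ⟨hσ.1, h _ hσ.2⟩
  | seq c d hc hd => exact hc (hd h)
  | ifz e c d hc hd =>
    intro σ hσ
    refine ⟨hσ.1, ?_⟩
    have h2 := hσ.2
    split_ifs with h0
    · rw [if_pos h0] at h2
      exact hc h _ h2
    · rw [if_neg h0] at h2
      exact hd h _ h2
  | loop e c hc =>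
    rintro σ ⟨k, hk⟩
    refine ⟨k, ?_⟩
    induction k generalizing σ with
    | zero => exact ⟨hk.1, hk.2.1, h _ hk.2.2⟩
    | succ k ih => exact ⟨hk.1, hk.2.1, hc ih _ hk.2.2⟩

/-- The rule for loops: `Inv k` holds whenever `k` iterations remain. -/
theorem wp_loop {I : List ℕ} {B : ℕ} {e : RAMExp n} {c : RAMCmd n} {Q : RAMState n → Prop}
    (Inv : ℕ → RAMState n → Prop)
    (bounded : ∀ k σ, Inv k σ → e.Bounded I B σ)
    (done : ∀ σ, Inv 0 σ → e.eval I σ = 0 ∧ Q σ)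
    (step : ∀ k σ, Inv (k + 1) σ → e.eval I σ ≠ 0 ∧ c.wp I B (Inv k) σ)
    (k : ℕ) (σ : RAMState n) (h : Inv k σ) : (RAMCmd.loop e c).wp I B Q σ := by
  refine ⟨k, ?_⟩
  induction k generalizing σ with
  | zero => exact ⟨bounded _ _ h, done _ h⟩
  | succ k ih => exact ⟨bounded _ _ h, (step _ _ h).1, c.wp_mono ih _ (step _ _ h).2⟩

end RAMCmd

/-! ### Correctness of the compilation -/

/-- The list `L` of instructions stands in the program `P` from line `p` on. -/
def CodeAt (P : List RAMInstr) (p : ℕ) (L : List RAMInstr) : Prop :=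
  ∃ A D, P = A ++ (L ++ D) ∧ A.length = p

theorem CodeAt.left {P : List RAMInstr} {p : ℕ} {L M : List RAMInstr}
    (h : CodeAt P p (L ++ M)) : CodeAt P p L := by
  obtain ⟨A, D, rfl, hA⟩ := h
  exact ⟨A, M ++ D, by simp, hA⟩

theorem CodeAt.right {P : List RAMInstr} {p : ℕ} {L M : List RAMInstr}
    (h : CodeAt P p (L ++ M)) : CodeAt P (p + L.length) M := by
  obtain ⟨A, D, rfl, hA⟩ := h
  exact ⟨A ++ L, D, by simp, by simp [hA]⟩

theorem CodeAt.getElem? {P : List RAMInstr} {p : ℕ} {i : RAMInstr} {L : List RAMInstr}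
    (h : CodeAt P p (i :: L)) : P[p]? = some i := by
  obtain ⟨A, D, rfl, rfl⟩ := h
  simp

theorem CodeAt.tail {P : List RAMInstr} {p : ℕ} {i : RAMInstr} {L : List RAMInstr}
    (h : CodeAt P p (i :: L)) : CodeAt P (p + 1) L :=
  CodeAt.right (L := [i]) h

/-- All register contents are less than `B`, and only registers below `M` are in use. -/
def RAMCfg.Good (M B : ℕ) (c : RAMCfg) : Prop :=
  ∀ r, c.reg r < B ∧ (M ≤ r → c.reg r = 0)

theorem RAMCfg.Good.set {M B : ℕ} {c : RAMCfg} (h : c.Good M B) {r v : ℕ} (hr : r < M)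
    (hv : v < B) : (c.set r v).Good M B := by
  intro q
  simp only [RAMCfg.set, Finsupp.update_apply]
  split_ifs with hq
  · exact ⟨hv, by omega⟩
  · exact h q

section Compilation

open Relation

/-- One step of the machine from a configuration within the bounds. -/
def GoodStep (P : List RAMInstr) (I : List ℕ) (M B : ℕ) (c d : RAMCfg) : Prop :=
  c.Good M B ∧ ramStep P I c = some d

theorem ramStep_eq {P : List RAMInstr} {I : List ℕ} {c : RAMCfg} {i : RAMInstr}
    (h : P[c.pc]? = some i) : ramStep P I c = c.exec I i := by
  simp [ramStep, h]

theorem goodStep_single {P : List RAMInstr} {I : List ℕ} {M B : ℕ} {c d : RAMCfg} {i : RAMInstr}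
    (hc : c.Good M B) (h : P[c.pc]? = some i) (hd : c.exec I i = some d) :
    ReflTransGen (GoodStep P I M B) c d :=
  ReflTransGen.single ⟨hc, (ramStep_eq h).trans hd⟩

/-- The registers of `c` hold the variables of `σ`, and the outputs agree. -/
def RAMCfg.Represents {n : ℕ} (c : RAMCfg) (σ : RAMState n) : Prop :=
  (∀ r : Fin n, c.reg r = σ.reg r) ∧ c.out = σ.out

variable {n : ℕ} {P : List RAMInstr} {I : List ℕ} {M B : ℕ}

/-- The code of an expression for target register `t` leaves the value of the expression in
register `t` and keeps the registers below, which include the variables. -/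
theorem RAMExp.compile_correct (e : RAMExp n) (σ : RAMState n) (t : ℕ) (c : RAMCfg)
    (hP : CodeAt P c.pc (e.compile t)) (hn : n ≤ t) (ht : t + e.temps ≤ M) (hc : c.Good M B)
    (hσ : c.Represents σ) (he : e.Bounded I B σ) :
    ∃ d : RAMCfg, ReflTransGen (GoodStep P I M B) c d ∧ d.Good M B ∧
      d.pc = c.pc + (e.compile t).length ∧ (∀ r < t, d.reg r = c.reg r) ∧ d.out = c.out ∧
      d.reg t = e.eval I σ := by
  -- the common part of the four binary operations, which differ in the final instruction `i` only
  have binary : ∀ (e f : RAMExp n) (i : RAMInstr) (v : ℕ) (t : ℕ) (c : RAMCfg)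
      (_ : CodeAt P c.pc (e.compile t ++ f.compile (t + 1) ++ [i])) (_ : n ≤ t)
      (_ : t + max e.temps (f.temps + 1) ≤ M) (_ : c.Good M B) (_ : c.Represents σ)
      (_ : v < B)
      (_ : ∀ d : RAMCfg, d.reg t = e.eval I σ → d.reg (t + 1) = f.eval I σ →
        d.exec I i = some (d.set t v))
      (_ : ∀ (t : ℕ) (c : RAMCfg) (_ : CodeAt P c.pc (e.compile t)) (_ : n ≤ t)
        (_ : t + e.temps ≤ M) (_ : c.Good M B) (_ : c.Represents σ),
        ∃ d : RAMCfg, ReflTransGen (GoodStep P I M B) c d ∧ d.Good M B ∧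
          d.pc = c.pc + (e.compile t).length ∧ (∀ r < t, d.reg r = c.reg r) ∧ d.out = c.out ∧
          d.reg t = e.eval I σ)
      (_ : ∀ (t : ℕ) (c : RAMCfg) (_ : CodeAt P c.pc (f.compile t)) (_ : n ≤ t)
        (_ : t + f.temps ≤ M) (_ : c.Good M B) (_ : c.Represents σ),
        ∃ d : RAMCfg, ReflTransGen (GoodStep P I M B) c d ∧ d.Good M B ∧
          d.pc = c.pc + (f.compile t).length ∧ (∀ r < t, d.reg r = c.reg r) ∧ d.out = c.out ∧
          d.reg t = f.eval I σ),
      ∃ d : RAMCfg, ReflTransGen (GoodStep P I M B) c d ∧ d.Good M B ∧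
        d.pc = c.pc + (e.compile t ++ f.compile (t + 1) ++ [i]).length ∧
        (∀ r < t, d.reg r = c.reg r) ∧ d.out = c.out ∧ d.reg t = v := by
    intro e f i v t c hP hn ht hc hσ hv hi he hf
    obtain ⟨d, hcd, hd, hpc, hreg, hout, hval⟩ := he t c hP.left.left hn (by omega) hc hσ
    have hσd : d.Represents σ :=
      ⟨fun r => (hreg r (r.isLt.trans_le hn)).trans (hσ.1 r), hout.trans hσ.2⟩
    obtain ⟨d', hcd', hd', hpc', hreg', hout', hval'⟩ :=
      hf (t + 1) d (hpc ▸ hP.left.right) (by omega) (by omega) hd hσd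
    have hP' : P[d'.pc]? = some i := by
      rw [hpc', hpc, add_assoc, ← List.length_append]
      exact hP.right.getElem?
    refine ⟨d'.set t v, hcd.trans (hcd'.trans (goodStep_single hd' hP' (hi d' ?_ hval'))),
      hd'.set (by omega) hv, ?_, ?_, ?_, ?_⟩
    · rw [hreg' t (by omega), hval]
    · simp [RAMCfg.set, hpc', hpc]; omega
    · intro r hr
      simp only [RAMCfg.set, Finsupp.update_apply]
      rw [if_neg (by omega), hreg' r (by omega), hreg r hr]
    · exact hout'.trans hout
    · simp [RAMCfg.set]
  induction e generalizing t c with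
  | var r =>
    have hv : c.reg r < B := (hc r).1
    have ht' : t < M := by simp only [temps] at ht; omega
    have hr : (r : ℕ) ≠ t := by have := r.isLt; omega
    have h0 : (c.set t 0).Good M B := hc.set ht' (by omega)
    refine ⟨(c.set t 0).set t (c.reg r), (goodStep_single hc hP.getElem? rfl).trans
      (goodStep_single (i := .add t r t) h0 hP.tail.getElem? ?_), h0.set ht' hv, ?_, ?_, rfl, ?_⟩
    · simp [RAMCfg.exec, RAMCfg.set, Finsupp.update_apply, hr]
    · simp [RAMCfg.set, compile]
    · intro q hq
      simp [RAMCfg.set, Finsupp.update_apply, hq.ne]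
    · simp [RAMCfg.set, eval, hσ.1]
  | lit k =>
    have ht' : t < M := by simp only [temps] at ht; omega
    refine ⟨c.set t k, goodStep_single hc hP.getElem? rfl, hc.set ht' he, ?_, ?_, rfl, ?_⟩
    · simp [RAMCfg.set, compile]
    · intro q hq
      simp [RAMCfg.set, Finsupp.update_apply, hq.ne]
    · simp [RAMCfg.set, eval]
  | add e f ihe ihf =>
    refine binary e f _ _ t c hP hn ht hc hσ he.eval_lt (fun d h1 h2 => ?_)
      (fun t c a1 a2 a3 a4 a5 => ihe t c a1 a2 a3 a4 a5 he.1)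
      (fun t c a1 a2 a3 a4 a5 => ihf t c a1 a2 a3 a4 a5 he.2.1)
    simp [RAMCfg.exec, h1, h2, eval]
  | sub e f ihe ihf =>
    refine binary e f _ _ t c hP hn ht hc hσ he.eval_lt (fun d h1 h2 => ?_)
      (fun t c a1 a2 a3 a4 a5 => ihe t c a1 a2 a3 a4 a5 he.1)
      (fun t c a1 a2 a3 a4 a5 => ihf t c a1 a2 a3 a4 a5 he.2)
    simp [RAMCfg.exec, h1, h2, eval]
  | mul e f ihe ihf =>
    refine binary e f _ _ t c hP hn ht hc hσ he.eval_lt (fun d h1 h2 => ?_)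
      (fun t c a1 a2 a3 a4 a5 => ihe t c a1 a2 a3 a4 a5 he.1)
      (fun t c a1 a2 a3 a4 a5 => ihf t c a1 a2 a3 a4 a5 he.2.1)
    simp [RAMCfg.exec, h1, h2, eval]
  | div e f ihe ihf =>
    refine binary e f _ _ t c hP hn ht hc hσ he.eval_lt (fun d h1 h2 => ?_)
      (fun t c a1 a2 a3 a4 a5 => ihe t c a1 a2 a3 a4 a5 he.1)
      (fun t c a1 a2 a3 a4 a5 => ihf t c a1 a2 a3 a4 a5 he.2)
    simp [RAMCfg.exec, h1, h2, eval]
  | read e ihe =>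
    obtain ⟨d, hcd, hd, hpc, hreg, hout, hval⟩ := ihe t c hP.left hn ht hc hσ he.1
    have ht' : t < M := by have := e.temps_pos; simp only [temps] at ht; omega
    refine ⟨d.set t (I.getD (d.reg t) 0),
      hcd.trans (goodStep_single hd (hpc ▸ hP.right.getElem?) rfl),
      hd.set ht' (hval ▸ he.2), ?_, ?_, hout, ?_⟩
    · simp [RAMCfg.set, compile, hpc]; omega
    · intro q hq
      simp [RAMCfg.set, Finsupp.update_apply, hq.ne, hreg q hq]
    · simp [RAMCfg.set, eval, hval]

/-- The code of an expression leaves its value in the first scratch register and keeps the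
variables. -/
theorem RAMExp.compile_represents (e : RAMExp n) {σ : RAMState n} {c : RAMCfg}
    (hP : CodeAt P c.pc (e.compile n)) (ht : n + e.temps ≤ M) (hc : c.Good M B)
    (hσ : c.Represents σ) (he : e.Bounded I B σ) :
    ∃ d : RAMCfg, ReflTransGen (GoodStep P I M B) c d ∧ d.Good M B ∧ d.Represents σ ∧
      d.pc = c.pc + (e.compile n).length ∧ d.reg n = e.eval I σ := by
  obtain ⟨d, hcd, hd, hpc, hreg, hout, hval⟩ := e.compile_correct σ n c hP le_rfl ht hc hσ he
  exact ⟨d, hcd, hd, ⟨fun r => (hreg r r.isLt).trans (hσ.1 r), hout.trans hσ.2⟩, hpc, hval⟩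

/-- The compiled program does what the weakest precondition promises. -/
theorem RAMCmd.compile_correct (a : RAMCmd n) (ht : n + a.temps ≤ M) (Q : RAMState n → Prop)
    (σ : RAMState n) (c : RAMCfg) (hP : CodeAt P c.pc (a.compile c.pc)) (hc : c.Good M B)
    (hσ : c.Represents σ) (h : a.wp I B Q σ) :
    ∃ (d : RAMCfg) (τ : RAMState n), ReflTransGen (GoodStep P I M B) c d ∧ d.Good M B ∧
      d.Represents τ ∧ d.pc = c.pc + a.size ∧ Q τ := by
  induction a generalizing Q σ c with
  | skip => exact ⟨c, σ, .refl, hc, hσ, rfl, h⟩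
  | assign r e =>
    obtain ⟨d, hcd, hd, hdσ, hpc, hval⟩ := e.compile_represents hP.left ht hc hσ h.1
    have hP' := hP.right
    rw [← hpc] at hP'
    have hr : (r : ℕ) < M := by have := r.isLt; omega
    have hrn : n ≠ (r : ℕ) := r.isLt.ne'
    have hv := h.1.eval_lt
    have h0 : (d.set r 0).Good M B := hd.set hr (by omega)
    refine ⟨(d.set r 0).set r (e.eval I σ), σ.set r (e.eval I σ),
      hcd.trans ((goodStep_single hd hP'.getElem? rfl).trans
      (goodStep_single (i := .add r n r) h0 hP'.tail.getElem? ?_)), h0.set hr hv,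
      ⟨?_, hdσ.2⟩, ?_, h.2⟩
    · simp [RAMCfg.exec, RAMCfg.set, Finsupp.update_apply, hrn, hval]
    · intro q
      simp only [RAMCfg.set, Finsupp.update_apply, RAMState.set_reg, Fin.ext_iff]
      split_ifs
      · rfl
      · exact hdσ.1 q
    · simp [RAMCfg.set, hpc, size]; omega
  | write e =>
    obtain ⟨d, hcd, hd, hdσ, hpc, hval⟩ := e.compile_represents hP.left ht hc hσ h.1
    have hP' := hP.right
    rw [← hpc] at hP'
    refine ⟨{ d with pc := d.pc + 1, out := d.out ++ [d.reg n] }, σ.emit (e.eval I σ),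
      hcd.trans (goodStep_single hd hP'.getElem? rfl), hd, ⟨hdσ.1, ?_⟩, ?_, h.2⟩
    · simp [RAMState.emit, hdσ.2, hval]
    · simp [hpc, size]; omega
  | seq a a' iha iha' =>
    simp only [temps] at ht
    obtain ⟨d, τ, hcd, hd, hdτ, hpc, hw⟩ := iha (by omega) _ σ c hP.left hc hσ h
    have hP' := hP.right
    rw [length_compile, ← hpc] at hP'
    obtain ⟨d', τ', hcd', hd', hdτ', hpc', hQ⟩ := iha' (by omega) _ τ d hP' hd hdτ hw
    exact ⟨d', τ', hcd.trans hcd', hd', hdτ', by simp only [size]; omega, hQ⟩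
  | ifz e a a' iha iha' =>
    simp only [temps] at ht
    obtain ⟨d, hcd, hd, hdσ, hpc, hval⟩ :=
      e.compile_represents hP.left.left.left.left (by omega) hc hσ h.1
    have hj := hP.left.left.left.right.getElem?
    rw [← hpc] at hj
    have h2 := h.2
    split_ifs at h2 with h0
    · have hP' := hP.right
      have hq : c.pc + (e.compile n ++
          [RAMInstr.jzero n (c.pc + (e.compile n).length + 1 + a'.size + 1)] ++
          a'.compile (c.pc + (e.compile n).length + 1) ++
          [RAMInstr.jump (c.pc + (e.compile n).length + 1 + a'.size + 1 + a.size)]).length =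
          c.pc + (e.compile n).length + 1 + a'.size + 1 := by
        simp [length_compile]; omega
      obtain ⟨d', τ', hcd', hd', hdτ', hpc', hQ⟩ := iha (by omega) Q σ
        { d with pc := c.pc + (e.compile n).length + 1 + a'.size + 1 }
        (by rw [hq] at hP'; exact hP') hd hdσ h2
      refine ⟨d', τ', hcd.trans (.trans (goodStep_single hd hj ?_) hcd'), hd', hdτ', ?_, hQ⟩
      · simp [RAMCfg.exec, hval, h0, hpc]
      · simp only [hpc', size]; omega
    · have hP' := hP.left.left.right
      obtain ⟨d', τ', hcd', hd', hdτ', hpc', hQ⟩ := iha' (by omega) Q σ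
        { d with pc := c.pc + (e.compile n).length + 1 }
        (by simpa [length_compile, add_assoc] using hP') hd hdσ h2
      have hend := hP.left.right.getElem?
      refine ⟨{ d' with pc := c.pc + (e.compile n).length + 1 + a'.size + 1 + a.size }, τ',
        hcd.trans (.trans (goodStep_single hd hj ?_)
          (hcd'.trans (goodStep_single hd' (i := .jump _) ?_ rfl))),
        hd', hdτ', ?_, hQ⟩
      · simp [RAMCfg.exec, hval, h0, hpc]
      · rw [hpc', ← hend]
        congr 1
        simp [length_compile]; omega
      · simp only [size]; omega
  | loop e a iha =>
    simp only [temps] at ht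
    obtain ⟨k, hk⟩ := h
    induction k generalizing σ c with
    | zero =>
      obtain ⟨d, hcd, hd, hdσ, hpc, hval⟩ :=
        e.compile_represents hP.left.left.left (by omega) hc hσ hk.1
      have hj := hP.left.left.right.getElem?
      rw [← hpc] at hj
      refine ⟨{ d with pc := c.pc + (e.compile n).length + 1 + a.size + 1 }, σ,
        hcd.trans (goodStep_single hd hj ?_), hd, hdσ, ?_, hk.2.2⟩
      · simp [RAMCfg.exec, hval, hk.2.1, hpc]
      · simp only [size]; omega
    | succ k ih =>
      obtain ⟨d, hcd, hd, hdσ, hpc, hval⟩ :=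
        e.compile_represents hP.left.left.left (by omega) hc hσ hk.1
      have hj := hP.left.left.right.getElem?
      rw [← hpc] at hj
      obtain ⟨d', τ', hcd', hd', hdτ', hpc', hW⟩ := iha (by omega) _ σ
        { d with pc := c.pc + (e.compile n).length + 1 }
        (by simpa [length_compile, add_assoc] using hP.left.right) hd hdσ hk.2.2
      have hend := hP.right.getElem?
      obtain ⟨d₂, τ₂, hcd₂, hd₂, hdτ₂, hpc₂, hQ⟩ := ih τ' { d' with pc := c.pc } hP hd' hdτ' hW
      refine ⟨d₂, τ₂, hcd.trans (.trans (goodStep_single hd hj ?_)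
        (hcd'.trans (.trans (goodStep_single hd' (i := .jump c.pc) ?_ rfl) hcd₂))),
        hd₂, hdτ₂, hpc₂, hQ⟩
      · simp [RAMCfg.exec, hval, hk.2.1, hpc]
      · rw [hpc', ← hend]
        congr 1
        simp [length_compile]; omega

theorem RAMCfg.Good.space_le {K : ℕ} {c : RAMCfg} (h : c.Good M (2 ^ K)) :
    c.space ≤ M * (M + K) := by
  have hs : c.reg.support ⊆ Finset.range M := by
    intro r hr
    by_contra hM
    exact Finsupp.mem_support_iff.1 hr ((h r).2 (by simpa using hM))
  calc c.space ≤ ∑ r ∈ Finset.range M, (Nat.size r + Nat.size (c.reg r)) :=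
        Finset.sum_le_sum_of_subset hs
    _ ≤ ∑ _r ∈ Finset.range M, (M + K) := by
        refine Finset.sum_le_sum fun r hr => add_le_add ?_ (Nat.size_le.2 (h r).1)
        rw [Nat.size_le]
        exact (Finset.mem_range.1 hr).trans Nat.lt_two_pow_self
    _ = M * (M + K) := by simp

/-- If the machine, without leaving the bounds, gets from `c` to a configuration in which it
stops, then everything reachable from `c` is within the bounds. -/
theorem good_of_reaches {c d e : RAMCfg} (hcd : ReflTransGen (GoodStep P I M B) c d)
    (hd : d.Good M B) (hhalt : ramStep P I d = none)
    (hce : StateTransition.Reaches (ramStep P I) c e) : e.Good M B := by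
  induction hcd using ReflTransGen.head_induction_on with
  | refl =>
    rcases hce.cases_head with rfl | ⟨f, hf, -⟩
    · exact hd
    · simp [hhalt] at hf
  | head hab _ ih =>
    rcases hce.cases_head with rfl | ⟨f, hf, hfe⟩
    · exact hab.1
    · rw [hab.2, Option.mem_some_iff] at hf
      exact ih (hf ▸ hfe)

/-- A structured program whose weakest precondition guarantees the output `O` with all values less
than `2 ^ K` computes `O` in space `O(K)`, the constant depending on the program only. -/
theorem RAMCmd.computesInSpace (a : RAMCmd n) {K S : ℕ} {O : List ℕ}
    (h : a.wp I (2 ^ K) (fun σ => σ.out = O) ⟨fun _ => 0, []⟩)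
    (hS : (n + a.temps) * (n + a.temps + K) ≤ S) :
    RAMComputesInSpace (a.compile 0) I O S := by
  have hinit : RAMCfg.init.Good (n + a.temps) (2 ^ K) := fun r => by simp [RAMCfg.init]
  obtain ⟨d, τ, hcd, hd, hdτ, hpc, hO⟩ := a.compile_correct (P := a.compile 0) le_rfl _ _
    RAMCfg.init ⟨[], [], by simp [RAMCfg.init], rfl⟩ hinit ⟨fun r => rfl, rfl⟩ h
  have hhalt : ramStep (a.compile 0) I d = none := by
    have : (a.compile 0)[d.pc]? = none := by
      rw [List.getElem?_eq_none_iff, length_compile, hpc]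
      exact Nat.le_add_left _ _
    simp [ramStep, this]
  refine ⟨⟨d, StateTransition.mem_eval.2 ⟨?_, hhalt⟩, hdτ.2.trans hO⟩, fun e he => ?_⟩
  · exact ReflTransGen.mono (p := fun a b => b ∈ ramStep _ I a) (fun _ _ hab => hab.2) _ _ hcd
  · exact (good_of_reaches hcd hd hhalt he).space_le.trans hS

end Compilation

/-! ### The tree of a circuit -/

/-- A value extended by `false` beyond its last bit. -/
def padBits {b : ℕ} (x : Fin b → Bool) (i : ℕ) : Bool := if h : i < b then x ⟨i, h⟩ else false

/-- The nodes of the tree, up to identification of nodes with equal subtrees. Gate `i` of the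
circuit has position `i + 1`, and block `m` consists of the positions `m * b + i` with `i < b`;
position `0` is void.

* Bit `i` of the value of `block m` is the value of the gate at position `m * b + i`.
* Bit `i` of the value of `wires t m k` is the bit on the left (`t = false`) or right (`t = true`)
  wire of the gate at position `m * b + i`, provided that this wire comes from a gate in one of the
  blocks `0, …, k - 1`; otherwise it is irrelevant. -/
inductive TreeNode where
  | block (m : ℕ)
  | wires (t : Bool) (m k : ℕ)

namespace TreeNode

/-- Child number `d` of a node. -/
def child : TreeNode → Fin 2 → TreeNode
  | block m, d => wires (d = 1) m m
  | wires t m 0, _ => wires t m 0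
  | wires t m (k + 1), d => if d = 1 then block k else wires t m k

/-- The height up to which the subtree at a node matters. -/
def rank : TreeNode → ℕ
  | block m => 2 * m + 1
  | wires _ _ k => 2 * k

theorem rank_child (v : TreeNode) (d : Fin 2) : (v.child d).rank ≤ v.rank - 1 := by
  rcases v with m | ⟨t, m, _ | k⟩
  · simp [child, rank]
  · simp [child, rank]
  · simp only [child]
    split_ifs <;> simp only [rank] <;> omega

end TreeNode

/-- The input wire of a gate on the left (`t = false`) or right (`t = true`) side. -/
def Gate.wire {i : ℕ} (g : Gate i) (t : Bool) : Wire i := if t then g.right else g.left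

/-- The position of the gate that a wire comes from, and `0` for a constant. -/
def Wire.pos {i : ℕ} : Wire i → ℕ
  | .gate j => j.val + 1
  | .const _ => 0

/-- The bit on a wire into block `m`: it is found among the bits of `acc` if the wire comes from
the block itself, and it is `ext` if the wire comes from an earlier block. -/
def Wire.blockVal {i : ℕ} (b m acc : ℕ) (ext : Bool) : Wire i → Bool
  | .gate j => if m * b ≤ j + 1 then acc.testBit (j + 1 - m * b) else ext
  | .const v => v

namespace Circuit

variable {s : ℕ}

/-- The position from which the wire on side `t` of the gate at position `p` comes, and `0` if
there is no such gate or the wire is constant. -/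
def wirePos (C : Circuit s) (t : Bool) (p : ℕ) : ℕ :=
  if h : 0 < p ∧ p ≤ s then ((C ⟨p - 1, by omega⟩).wire t).pos else 0

/-- The value of the gate at position `m * b + i`, computed from the earlier values in its block,
which are the bits of `acc`, and the values `x` and `y` of its wires from earlier blocks. -/
def blockBit (C : Circuit s) (b m : ℕ) (x y : ℕ → Bool) (acc i : ℕ) : Bool :=
  if h : 0 < m * b + i ∧ m * b + i ≤ s then
    let g := C ⟨m * b + i - 1, by omega⟩
    g.op (g.left.blockVal b m acc (x i)) (g.right.blockVal b m acc (y i))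
  else false

theorem wirePos_eq (C : Circuit s) (t : Bool) {p : ℕ} (g : Fin s) (hp : p = g + 1) :
    C.wirePos t p = ((C g).wire t).pos := by
  subst hp
  exact dif_pos ⟨g.val.succ_pos, g.isLt⟩

theorem blockBit_eq (C : Circuit s) {b m : ℕ} (x y : ℕ → Bool) (acc : ℕ) {i : ℕ} (g : Fin s)
    (hg : m * b + i = g + 1) :
    C.blockBit b m x y acc i =
      (C g).op ((C g).left.blockVal b m acc (x i)) ((C g).right.blockVal b m acc (y i)) := by
  obtain ⟨a, ha⟩ := g
  obtain rfl : a = m * b + i - 1 := by simp only at hg; omega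
  rw [blockBit, dif_pos (by simp only at hg; omega)]

/-- The number whose binary digits are the first `i` values of block `m`. -/
def blockAcc (C : Circuit s) (b m : ℕ) (x y : ℕ → Bool) : ℕ → ℕ
  | 0 => 0
  | i + 1 => C.blockAcc b m x y i + 2 ^ i * (C.blockBit b m x y (C.blockAcc b m x y i) i).toNat

theorem blockAcc_lt (C : Circuit s) (b m : ℕ) (x y : ℕ → Bool) (i : ℕ) :
    C.blockAcc b m x y i < 2 ^ i := by
  induction i with
  | zero => simp [blockAcc]
  | succ i ih =>
    rw [blockAcc, pow_succ]
    cases C.blockBit b m x y (C.blockAcc b m x y i) i <;> simp <;> omega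

theorem testBit_blockAcc (C : Circuit s) (b m : ℕ) (x y : ℕ → Bool) {i j : ℕ} (h : j < i) :
    (C.blockAcc b m x y i).testBit j = C.blockBit b m x y (C.blockAcc b m x y j) j := by
  induction i with
  | zero => omega
  | succ i ih =>
    have hlt := C.blockAcc_lt b m x y i
    rw [blockAcc, add_comm, Nat.testBit_two_pow_mul_add _ hlt]
    rcases Nat.lt_succ_iff_lt_or_eq.1 h with h | rfl
    · rw [if_pos h, ih h]
    · cases C.blockBit b m x y (C.blockAcc b m x y j) j <;> simp

/-- The function at a node of the tree. For `wires t m (k + 1)`, the position of a wire decides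
whether its bit is taken from block `k`, which is the value `y`, or from `x`. -/
def nodeFn (C : Circuit s) {b : ℕ} : TreeNode → (x y : Fin b → Bool) → Fin b → Bool
  | .block m, x, y => fun i =>
      C.blockBit b m (padBits x) (padBits y) (C.blockAcc b m (padBits x) (padBits y) i) i
  | .wires _ _ 0, _, _ => fun _ => false
  | .wires t m (k + 1), x, y => fun i =>
      if k * b ≤ C.wirePos t (m * b + i) then padBits y (C.wirePos t (m * b + i) - k * b) else x i

/-- The bits of `v` that matter are those that the description of the node demands. -/
def Valid (C : Circuit s) {b : ℕ} : TreeNode → (Fin b → Bool) → Prop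
  | .block m, v => ∀ (i : Fin b) (g : Fin s), m * b + i = g + 1 → v i = C.val g
  | .wires t m k, v => ∀ (i : Fin b) (g : Fin s) (j : Fin g), m * b + i = g + 1 →
      (C g).wire t = .gate j → j + 1 < k * b → v i = C.val ⟨j, j.isLt.trans g.isLt⟩

/-- Inside block `m`, the wires of a gate are resolved correctly, provided that the earlier bits of
the block are correct and that `z` has the bits that come from earlier blocks. -/
theorem blockVal_eq (C : Circuit s) {b m i : ℕ} (hi : i < b) (x y z : Fin b → Bool) (g : Fin s)
    (hg : m * b + i = g + 1) (t : Bool) (hz : C.Valid (.wires t m m) z)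
    (ih : ∀ i' < i, ∀ g' : Fin s, m * b + i' = g' + 1 →
      C.blockBit b m (padBits x) (padBits y) (C.blockAcc b m (padBits x) (padBits y) i') i' =
        C.val g') :
    ((C g).wire t).blockVal b m (C.blockAcc b m (padBits x) (padBits y) i) (padBits z i) =
      ((C g).wire t).val fun j => C.val ⟨j, j.isLt.trans g.isLt⟩ := by
  cases hw : (C g).wire t with
  | const v => rfl
  | gate j =>
    have hj := j.isLt
    simp only [Wire.blockVal, Wire.val]
    split_ifs with h
    · rw [testBit_blockAcc _ _ _ _ _ (by omega)]
      exact ih _ (by omega) ⟨j, j.isLt.trans g.isLt⟩ (by simp; omega)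
    · rw [padBits, dif_pos hi]
      exact hz ⟨i, hi⟩ g j hg hw (by omega)

/-- The function at a node turns correct values of the children into a correct value. -/
theorem valid_nodeFn (C : Circuit s) {b : ℕ} (v : TreeNode) (x y : Fin b → Bool)
    (hx : C.Valid (v.child 0) x) (hy : C.Valid (v.child 1) y) : C.Valid v (C.nodeFn v x y) := by
  rcases v with m | ⟨t, m, _ | k⟩
  · simp only [TreeNode.child] at hx hy
    rintro ⟨i, hi⟩ g hg
    simp only [nodeFn]
    induction i using Nat.strong_induction_on generalizing g with
    | _ i ih =>
      have ih' := fun i' (h : i' < i) => ih i' h (h.trans hi)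
      have hl := C.blockVal_eq hi x y x g hg false hx ih'
      have hr := C.blockVal_eq hi x y y g hg true hy ih'
      rw [C.blockBit_eq _ _ _ g hg, Circuit.val]
      exact congrArg₂ _ hl hr
  · intro i g j _ _ hj
    simp at hj
  · rintro i g j hg hw hj
    simp only [TreeNode.child] at hx hy
    have hpos : C.wirePos t (m * b + i) = j + 1 := by
      rw [C.wirePos_eq t g hg, hw, Wire.pos]
    simp only [nodeFn, hpos]
    split_ifs with h
    · rw [add_mul, one_mul] at hj
      rw [padBits, dif_pos (by omega)]
      exact hy ⟨j + 1 - k * b, _⟩ ⟨j, j.isLt.trans g.isLt⟩ (by simp; omega)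
    · exact hx i g j hg hw (by omega)

/-- The node of the description reached from the root along a path. -/
def nodeAt (s b : ℕ) (u : List (Fin 2)) : TreeNode := u.foldl TreeNode.child (.block (s / b))

theorem rank_nodeAt (s b : ℕ) (u : List (Fin 2)) :
    (nodeAt s b u).rank ≤ 2 * (s / b) + 1 - u.length := by
  induction u using List.reverseRecOn with
  | nil => simp [nodeAt, TreeNode.rank]
  | append_singleton u d ih =>
    have := (nodeAt s b u).rank_child d
    simp only [nodeAt, List.foldl_append, List.foldl_cons, List.foldl_nil, List.length_append,
      List.length_singleton] at *
    omega

/-- The tree evaluation instance of a circuit. -/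
def tree (C : Circuit s) (b : ℕ) : TreeEval 2 (2 * (s / b) + 1) b where
  leaf u _ := C.nodeFn (nodeAt s b u) (fun _ => false) (fun _ => false)
  node u _ z := C.nodeFn (nodeAt s b u) (z 0) (z 1)

theorem nodeFn_of_rank_eq_zero (C : Circuit s) {b : ℕ} {v : TreeNode} (h : v.rank = 0)
    (x y : Fin b → Bool) : C.nodeFn v x y = fun _ => false := by
  rcases v with m | ⟨t, m, _ | k⟩
  · simp [TreeNode.rank] at h
  · rfl
  · simp [TreeNode.rank] at h

/-- At a leaf the labels of the (fictitious) children do not matter, because leaves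
have rank `0`. -/
theorem tree_fn (C : Circuit s) (b : ℕ) (u : List (Fin 2)) (hu : u.length ≤ 2 * (s / b) + 1)
    (z : Fin 2 → Fin b → Bool) : (C.tree b).fn u hu z = C.nodeFn (nodeAt s b u) (z 0) (z 1) := by
  rw [TreeEval.fn]
  split_ifs with hl
  · have hr : (nodeAt s b u).rank = 0 := by have := rank_nodeAt s b u; omega
    simp only [tree, C.nodeFn_of_rank_eq_zero hr]
  · rfl

theorem valid_tree_val (C : Circuit s) (b : ℕ) (u : List (Fin 2))
    (hu : u.length ≤ 2 * (s / b) + 1) : C.Valid (nodeAt s b u) ((C.tree b).val u hu) := by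
  induction hn : 2 * (s / b) + 1 - u.length generalizing u with
  | zero =>
    have hr := rank_nodeAt s b u
    generalize nodeAt s b u = v at hr ⊢
    generalize TreeEval.val _ u hu = w
    rcases v with m | ⟨t, m, k⟩
    · simp only [TreeNode.rank] at hr; omega
    · obtain rfl : k = 0 := by simp only [TreeNode.rank] at hr; omega
      intro i g j _ _ hj
      simp at hj
  | succ n ih =>
    have hl : u.length ≠ 2 * (s / b) + 1 := by omega
    rw [TreeEval.val, dif_neg hl]
    have hc : ∀ d, nodeAt s b (u ++ [d]) = (nodeAt s b u).child d := fun d => by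
      simp [nodeAt]
    refine C.valid_nodeFn _ _ _ ?_ ?_
    · rw [← hc]
      exact ih _ (by simp; omega) (by simp; omega)
    · rw [← hc]
      exact ih _ (by simp; omega) (by simp; omega)

/-- The last gate is the one at position `s`, which is position `s % b` of block `s / b`. -/
theorem tree_rootVal (C : Circuit s) {b : ℕ} (hb : 0 < b) (hs : 0 < s) :
    (C.tree b).rootVal ⟨s % b, Nat.mod_lt s hb⟩ = C.output hs := by
  refine C.valid_tree_val b [] (Nat.zero_le _) ⟨s % b, _⟩ ⟨s - 1, _⟩ ?_
  have := Nat.div_add_mod' s b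
  simp only
  omega

end Circuit

/-! ### Access to the input array -/

theorem List.getD_flatMap_of_length {α β : Type*} (f : α → List β) {n : ℕ}
    (hf : ∀ a, (f a).length = n) (l : List α) (i k : ℕ) (hi : i < l.length) (hk : k < n) (z : β) :
    (l.flatMap f).getD (n * i + k) z = (f l[i]).getD k z := by
  induction l generalizing i with
  | nil => simp at hi
  | cons a l ih =>
    rw [List.flatMap_cons]
    cases i with
    | zero =>
      rw [List.getD_append _ _ _ _ (by rw [hf]; omega)]
      simp
    | succ i =>
      rw [List.getD_append_right _ _ _ _ (by rw [hf, mul_add]; omega), hf]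
      rw [show n * (i + 1) + k - n = n * i + k by rw [mul_add]; omega]
      simpa using ih i (by simpa using hi)

theorem getD_bitList {b : ℕ} (x : Fin b → Bool) (i : ℕ) :
    (bitList x).getD i 0 = (padBits x i).toNat := by
  rw [bitList, List.getD_eq_getElem?_getD, List.getElem?_ofFn, padBits]
  split_ifs <;> simp

theorem Circuit.length_code {s : ℕ} (C : Circuit s) : C.code.length = 3 * s := by
  simp [Circuit.code, List.length_flatMap, mul_comm]

theorem Circuit.getD_code {s : ℕ} (C : Circuit s) (g : Fin s) (k : ℕ) (hk : k < 3) :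
    C.code.getD (3 * g + k) 0 = [(C g).left.code, (C g).right.code, opCode (C g).op].getD k 0 := by
  rw [Circuit.code, List.getD_flatMap_of_length (n := 3) _ (fun _ => rfl) _ _ _ (by simp) hk]
  rw [List.getElem_finRange]
  rfl

section localInput

variable {s b : ℕ} (C : Circuit s) (u : List (Fin 2)) (x y : Fin b → Bool)

theorem getD_localInput_code (g : Fin s) (k : ℕ) (hk : k < 3) :
    (localInput C u x y).getD (3 * (g + 1) + k) 0 =
      [(C g).left.code, (C g).right.code, opCode (C g).op].getD k 0 := by
  have hg := g.isLt
  have hl := C.length_code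
  rw [localInput, List.append_assoc, List.append_assoc, List.append_assoc,
    List.getD_append_right _ _ _ _ (by simp; omega), List.getD_append _ _ _ _ (by simp; omega),
    ← C.getD_code g k hk]
  congr 1
  simp; omega

theorem getD_localInput_node (i : ℕ) (hi : i < u.length) :
    (localInput C u x y).getD (3 + 3 * s + i) 0 = u[i] := by
  have hl := C.length_code
  rw [localInput, List.append_assoc, List.getD_append _ _ _ _ (by simp; omega),
    List.getD_append_right _ _ _ _ (by simp; omega)]
  have h : 3 + 3 * s + i - ([s, b, u.length] ++ C.code).length = i := by simp; omega
  rw [h]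
  simp [List.getD_eq_getElem?_getD, hi]

theorem getD_localInput_left (i : ℕ) (hi : i < b) :
    (localInput C u x y).getD (3 + 3 * s + u.length + i) 0 = (padBits x i).toNat := by
  have hl := C.length_code
  have hb : (bitList x).length = b := by simp [bitList]
  rw [localInput, List.getD_append _ _ _ _ (by simp; omega),
    List.getD_append_right _ _ _ _ (by simp; omega), ← getD_bitList]
  congr 1
  simp; omega

theorem getD_localInput_right (i : ℕ) :
    (localInput C u x y).getD (3 + 3 * s + u.length + b + i) 0 = (padBits y i).toNat := by
  have hl := C.length_code
  have hb : (bitList x).length = b := by simp [bitList]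
  rw [localInput, List.getD_append_right _ _ _ _ (by simp; omega), ← getD_bitList]
  congr 1
  simp; omega

end localInput

/-- The code of the wire on side `t` of the gate at position `p`, and `0` if there is none. -/
def Circuit.wireCode {s : ℕ} (C : Circuit s) (t : Bool) (p : ℕ) : ℕ :=
  if h : 0 < p ∧ p ≤ s then ((C ⟨p - 1, by omega⟩).wire t).code else 0

/-- The code of the truth table of the gate at position `p`, and `0` if there is none. -/
def Circuit.opCodeAt {s : ℕ} (C : Circuit s) (p : ℕ) : ℕ :=
  if h : 0 < p ∧ p ≤ s then opCode (C ⟨p - 1, by omega⟩).op else 0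

theorem opCode_lt (f : Bool → Bool → Bool) : opCode f < 16 := by
  unfold opCode
  cases f false false <;> cases f false true <;> cases f true false <;> cases f true true <;> simp

theorem testBit_opCode (f : Bool → Bool → Bool) (l r : Bool) :
    (opCode f).testBit (2 * l.toNat + r.toNat) = f l r := by
  unfold opCode
  cases l <;> cases r <;> cases f false false <;> cases f false true <;> cases f true false <;>
    cases f true true <;> rfl

theorem Wire.code_le {i : ℕ} (w : Wire i) : w.code ≤ i + 1 := by
  rcases w with j | v
  · simp only [Wire.code]; omega
  · cases v <;> simp [Wire.code]

theorem Wire.pos_eq {i : ℕ} (w : Wire i) : w.pos = w.code - 1 := by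
  rcases w with j | v
  · rfl
  · cases v <;> rfl

theorem Circuit.wireCode_le {s : ℕ} (C : Circuit s) (t : Bool) (p : ℕ) :
    C.wireCode t p ≤ s + 1 := by
  rw [wireCode]
  split_ifs with h
  · exact (Wire.code_le _).trans (by simp only; omega)
  · omega

theorem Circuit.opCodeAt_lt {s : ℕ} (C : Circuit s) (p : ℕ) : C.opCodeAt p < 16 := by
  rw [opCodeAt]
  split_ifs with h
  · exact opCode_lt _
  · omega

theorem Circuit.wirePos_eq_wireCode {s : ℕ} (C : Circuit s) (t : Bool) (p : ℕ) :
    C.wirePos t p = C.wireCode t p - 1 := by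
  rw [wirePos, wireCode]
  split_ifs
  · exact Wire.pos_eq _
  · rfl

/-- The bit on a wire with code `c` into block `m`; see `Wire.blockVal`. -/
def wireBit (b m acc : ℕ) (ext : Bool) (c : ℕ) : Bool :=
  if c < 2 then c = 1 else if m * b ≤ c - 1 then acc.testBit (c - 1 - m * b) else ext

theorem wireBit_code {i : ℕ} (b m acc : ℕ) (ext : Bool) (w : Wire i) :
    wireBit b m acc ext w.code = w.blockVal b m acc ext := by
  rcases w with j | v
  · rw [wireBit, if_neg (by simp only [Wire.code]; omega)]
    rfl
  · cases v <;> simp [wireBit, Wire.code, Wire.blockVal]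

/-- The value of a gate can be computed from the codes of its wires and its truth table. -/
theorem Circuit.blockBit_eq_testBit {s : ℕ} (C : Circuit s) (b m : ℕ) (x y : ℕ → Bool)
    (acc i : ℕ) :
    C.blockBit b m x y acc i = (C.opCodeAt (m * b + i)).testBit
      (2 * (wireBit b m acc (x i) (C.wireCode false (m * b + i))).toNat +
        (wireBit b m acc (y i) (C.wireCode true (m * b + i))).toNat) := by
  rw [blockBit, opCodeAt, wireCode, wireCode]
  split_ifs with h
  · rw [wireBit_code, wireBit_code, testBit_opCode]
    rfl
  · simp

/-! ### Programs that compute the local functions -/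

namespace RAMExp

variable {n : ℕ}

instance : Add (RAMExp n) := ⟨add⟩
instance : Sub (RAMExp n) := ⟨sub⟩
instance : Mul (RAMExp n) := ⟨mul⟩
instance : Div (RAMExp n) := ⟨div⟩
instance (k : ℕ) : OfNat (RAMExp n) k := ⟨lit k⟩

variable (I : List ℕ) (B : ℕ) (σ : RAMState n) (e f : RAMExp n)

theorem eval_var (r : Fin n) : (var r).eval I σ = σ.reg r := rfl
theorem eval_ofNat (k : ℕ) :
    eval I σ (no_index (OfNat.ofNat k : RAMExp n)) = (OfNat.ofNat k : ℕ) := rfl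
theorem eval_add : (e + f).eval I σ = e.eval I σ + f.eval I σ := rfl
theorem eval_sub : (e - f).eval I σ = e.eval I σ - f.eval I σ := rfl
theorem eval_mul : (e * f).eval I σ = e.eval I σ * f.eval I σ := rfl
theorem eval_div : (e / f).eval I σ = e.eval I σ / f.eval I σ := rfl
theorem eval_read : (read e).eval I σ = I.getD (e.eval I σ) 0 := rfl

theorem bounded_var (r : Fin n) : (var r).Bounded I B σ ↔ σ.reg r < B := .rfl
theorem bounded_ofNat (k : ℕ) :
    Bounded I B σ (no_index (OfNat.ofNat k : RAMExp n)) ↔ (OfNat.ofNat k : ℕ) < B := .rfl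
theorem bounded_add : (e + f).Bounded I B σ ↔
    e.Bounded I B σ ∧ f.Bounded I B σ ∧ e.eval I σ + f.eval I σ < B := .rfl
theorem bounded_sub : (e - f).Bounded I B σ ↔ e.Bounded I B σ ∧ f.Bounded I B σ := .rfl
theorem bounded_mul : (e * f).Bounded I B σ ↔
    e.Bounded I B σ ∧ f.Bounded I B σ ∧ e.eval I σ * f.eval I σ < B := .rfl
theorem bounded_div : (e / f).Bounded I B σ ↔ e.Bounded I B σ ∧ f.Bounded I B σ := .rfl
theorem bounded_read : (read e).Bounded I B σ ↔
    e.Bounded I B σ ∧ I.getD (e.eval I σ) 0 < B := .rfl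

end RAMExp

namespace RAMCmd

variable {n : ℕ} (I : List ℕ) (B : ℕ) (Q : RAMState n → Prop) (σ : RAMState n)

theorem wp_skip : (skip : RAMCmd n).wp I B Q σ ↔ Q σ := .rfl
theorem wp_assign (r : Fin n) (e : RAMExp n) : (assign r e).wp I B Q σ ↔
    e.Bounded I B σ ∧ Q (σ.set r (e.eval I σ)) := .rfl
theorem wp_write (e : RAMExp n) : (write e).wp I B Q σ ↔
    e.Bounded I B σ ∧ Q (σ.emit (e.eval I σ)) := .rfl
theorem wp_seq (c d : RAMCmd n) : (seq c d).wp I B Q σ ↔ c.wp I B (d.wp I B Q) σ := .rfl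
theorem wp_ifz (e : RAMExp n) (c d : RAMCmd n) : (ifz e c d).wp I B Q σ ↔
    e.Bounded I B σ ∧ if e.eval I σ = 0 then c.wp I B Q σ else d.wp I B Q σ := .rfl

end RAMCmd

/-- The states `σ` and `τ` have the same output, and the same variables except possibly those
in `L`. -/
def RAMState.AgreeOff {n : ℕ} (L : List (Fin n)) (σ τ : RAMState n) : Prop :=
  (∀ r, r ∉ L → τ.reg r = σ.reg r) ∧ τ.out = σ.out

/-! The variables of the programs: the header of the input (`rSize`, `rWidth`), a loop counter and
an index into the input array (`rCount`, `rPtr`), the description of a node (`rKind`, which is `0`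
for `block` and `1` for `wires`, `rSide`, `rBlock`, `rBelow`), a position and the codes of the gate
there (`rPos`, `rLeft`, `rRight`, `rOp`), the bits of the current block and the next power of two
(`rAcc`, `rPow`), and auxiliary ones. -/

local infix:60 "≔" => RAMCmd.assign
local infixr:50 ";;" => RAMCmd.seq
local prefix:max "&" => RAMExp.var

local notation "rSize" => (0 : Fin 17)
local notation "rWidth" => (1 : Fin 17)
local notation "rCount" => (2 : Fin 17)
local notation "rPtr" => (3 : Fin 17)
local notation "rKind" => (4 : Fin 17)
local notation "rSide" => (5 : Fin 17)
local notation "rBlock" => (6 : Fin 17)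
local notation "rBelow" => (7 : Fin 17)
local notation "rTmp" => (8 : Fin 17)
local notation "rPos" => (9 : Fin 17)
local notation "rAcc" => (10 : Fin 17)
local notation "rPow" => (11 : Fin 17)
local notation "rLeft" => (12 : Fin 17)
local notation "rRight" => (13 : Fin 17)
local notation "rOp" => (14 : Fin 17)
local notation "rShift" => (15 : Fin 17)
local notation "rBit" => (16 : Fin 17)

/-- Replace the number in `rBit` by its binary digit number `rShift`. -/
def bitCmd : RAMCmd 17 :=
  .loop &rShift (rBit ≔ &rBit / 2 ;; rShift ≔ &rShift - 1) ;;
  rBit ≔ &rBit - &rBit / 2 * 2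

theorem wp_bitCmd {I : List ℕ} {B : ℕ} {Q : RAMState 17 → Prop} {σ : RAMState 17} (hB : 2 < B)
    (hw : σ.reg rBit < B) (hs : σ.reg rShift < B)
    (hQ : ∀ τ, σ.AgreeOff [rShift, rBit] τ →
      τ.reg rBit = ((σ.reg rBit).testBit (σ.reg rShift)).toNat → Q τ) :
    bitCmd.wp I B Q σ := by
  rw [bitCmd, RAMCmd.wp_seq]
  refine RAMCmd.wp_loop (fun k τ => τ.reg rShift = k ∧ k < B ∧ τ.reg rBit < B ∧
    σ.AgreeOff [rShift, rBit] τ ∧ (τ.reg rBit).testBit k = (σ.reg rBit).testBit (σ.reg rShift))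
    ?_ ?_ ?_ _ σ ⟨rfl, hs, hw, ⟨fun _ _ => rfl, rfl⟩, rfl⟩
  · rintro k τ ⟨rfl, h, -⟩
    exact h
  · rintro τ ⟨h0, -, h1, h2, h3⟩
    refine ⟨h0, ?_⟩
    have hm := Nat.div_add_mod (τ.reg rBit) 2
    simp only [RAMCmd.wp_assign, RAMExp.eval_var, RAMExp.eval_ofNat, RAMExp.eval_sub,
      RAMExp.eval_mul, RAMExp.eval_div, RAMExp.bounded_var, RAMExp.bounded_ofNat,
      RAMExp.bounded_sub, RAMExp.bounded_mul, RAMExp.bounded_div]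
    refine ⟨⟨h1, ⟨h1, hB⟩, hB, by omega⟩, hQ _ ⟨fun r hr => ?_, h2.2⟩ ?_⟩
    · rw [← h2.1 r hr, RAMState.set_reg, if_neg]
      rintro rfl
      simp at hr
    · rw [RAMState.set_reg, if_pos rfl, ← h3, Nat.toNat_testBit, pow_zero, Nat.div_one]
      omega
  · rintro k τ ⟨h0, hk, h1, h2, h3⟩
    refine ⟨by rw [RAMExp.eval_var, h0]; omega, ?_⟩
    simp only [RAMCmd.wp_seq, RAMCmd.wp_assign, RAMExp.eval_var, RAMExp.eval_ofNat,
      RAMExp.eval_sub, RAMExp.eval_div, RAMExp.bounded_var, RAMExp.bounded_ofNat,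
      RAMExp.bounded_sub, RAMExp.bounded_div, RAMState.set_reg, if_true]
    refine ⟨⟨h1, hB⟩, ⟨?_, by omega⟩, ?_, by omega, ?_, ⟨fun r hr => ?_, h2.2⟩, ?_⟩
    · simp; omega
    · simp [h0]
    · simpa using (Nat.div_le_self _ _).trans_lt h1
    · rw [← h2.1 r hr, RAMState.set_reg, RAMState.set_reg, if_neg, if_neg]
      · rintro rfl; simp at hr
      · rintro rfl; simp at hr
    · simp [← h3, Nat.testBit_succ]

/-- Replace the code of a wire in `c` by the bit on this wire. If the wire comes from an earlier
block, this bit is found in the input array, at the index given by `e`. -/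
def resolveCmd (c : Fin 17) (e : RAMExp 17) : RAMCmd 17 :=
  .ifz (&c / 2) .skip
    (.ifz (&rBlock * &rWidth - (&c - 1))
      (rShift ≔ &c - 1 - &rBlock * &rWidth ;; rBit ≔ &rAcc ;; bitCmd ;; c ≔ &rBit)
      (c ≔ .read e))

theorem wp_resolveCmd {I : List ℕ} {B : ℕ} {Q : RAMState 17 → Prop} {σ : RAMState 17}
    {c : Fin 17} {e : RAMExp 17} {b m acc : ℕ} {ext : Bool} (hB : 2 < B)
    (hcB : σ.reg c < B) (hb : σ.reg rWidth = b)
    (hm : σ.reg rBlock = m) (hacc : σ.reg rAcc = acc) (hbB : b < B) (hmB : m < B)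
    (hmb : m * b < B) (haccB : acc < B) (he : e.Bounded I B σ)
    (hext : I.getD (e.eval I σ) 0 = ext.toNat)
    (hQ : ∀ τ, σ.AgreeOff [c, rShift, rBit] τ →
      τ.reg c = (wireBit b m acc ext (σ.reg c)).toNat → Q τ) :
    (resolveCmd c e).wp I B Q σ := by
  have hext2 : ext.toNat < B := (Bool.toNat_le ext).trans_lt (by omega)
  have h1 : 1 < B := by omega
  simp only [resolveCmd, RAMCmd.wp_seq, RAMCmd.wp_assign, RAMCmd.wp_ifz, RAMCmd.wp_skip,
    RAMExp.eval_var, RAMExp.eval_ofNat,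
    RAMExp.eval_sub, RAMExp.eval_div, RAMExp.eval_mul, RAMExp.eval_read, RAMExp.bounded_var,
    RAMExp.bounded_ofNat, RAMExp.bounded_sub, RAMExp.bounded_div, RAMExp.bounded_mul,
    RAMExp.bounded_read, hb, hm, hext]
  refine ⟨⟨hcB, hB⟩, ?_⟩
  split_ifs with h2 h3
  · refine hQ σ ⟨fun _ _ => rfl, rfl⟩ ?_
    rw [wireBit, if_pos (by omega)]
    have : σ.reg c = 0 ∨ σ.reg c = 1 := by omega
    rcases this with h | h <;> simp [h]
  · refine ⟨⟨⟨hmB, hbB, hmb⟩, hcB, h1⟩, ⟨⟨hcB, h1⟩, hmB, hbB, hmb⟩, ?_, ?_⟩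
    · simpa [RAMState.set_reg, hacc] using haccB
    · refine wp_bitCmd hB ?_ ?_ ?_
      · simpa [RAMState.set_reg, hacc] using haccB
      · simp [RAMState.set_reg]; omega
      · intro τ hτ hbit
        have hbit' : τ.reg rBit = (wireBit b m acc ext (σ.reg c)).toNat := by
          rw [hbit, wireBit, if_neg (by omega), if_pos (by omega)]
          simp [RAMState.set_reg, hacc]
        refine ⟨?_, hQ _ ⟨fun r hr => ?_, hτ.2⟩ ?_⟩
        · exact (congrArg (· < B) hbit').mpr ((Bool.toNat_le _).trans_lt h1)
        · simp only [List.mem_cons, List.not_mem_nil, or_false, not_or] at hr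
          rw [RAMState.set_reg, if_neg hr.1, hτ.1 r (by simp [hr]), RAMState.set_reg,
            if_neg hr.2.2, RAMState.set_reg, if_neg hr.2.1]
        · rw [RAMState.set_reg, if_pos rfl, RAMExp.eval_var, hbit']
  · refine ⟨⟨⟨hmB, hbB, hmb⟩, hcB, h1⟩, ⟨he, hext2⟩, hQ _ ⟨fun r hr => ?_, rfl⟩ ?_⟩
    · simp only [List.mem_cons, not_or] at hr
      rw [RAMState.set_reg, if_neg hr.1]
    · rw [RAMState.set_reg, if_pos rfl, wireBit, if_neg (by omega), if_neg (by omega)]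

/-- Fetch the codes of the gate at position `rPos`. -/
def fetchCmd : RAMCmd 17 :=
  rLeft ≔ 0 ;; rRight ≔ 0 ;; rOp ≔ 0 ;;
  .ifz &rPos .skip
    (.ifz (&rPos - &rSize)
      (rLeft ≔ .read (3 * &rPos) ;; rRight ≔ .read (3 * &rPos + 1) ;;
        rOp ≔ .read (3 * &rPos + 2))
      .skip)

theorem wp_fetchCmd {s b : ℕ} (C : Circuit s) (u : List (Fin 2)) (x y : Fin b → Bool) {B : ℕ}
    {Q : RAMState 17 → Prop} {σ : RAMState 17} {p : ℕ} (hB : 16 < B) (hs : 8 * s < B)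
    (hS : σ.reg rSize = s) (hp : σ.reg rPos = p) (hpB : 3 * p + 2 < B)
    (hQ : ∀ τ, σ.AgreeOff [rLeft, rRight, rOp] τ → τ.reg rLeft = C.wireCode false p →
      τ.reg rRight = C.wireCode true p → τ.reg rOp = C.opCodeAt p → Q τ) :
    fetchCmd.wp (localInput C u x y) B Q σ := by
  simp only [fetchCmd, RAMCmd.wp_seq, RAMCmd.wp_assign, RAMCmd.wp_ifz, RAMCmd.wp_skip,
    RAMExp.eval_var, RAMExp.eval_ofNat, RAMExp.eval_sub, RAMExp.eval_mul, RAMExp.eval_add,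
    RAMExp.eval_read, RAMExp.bounded_var, RAMExp.bounded_ofNat, RAMExp.bounded_sub,
    RAMExp.bounded_add, RAMExp.bounded_mul, RAMExp.bounded_read, RAMState.set_reg, hS, hp,
    Fin.isValue, Fin.reduceEq, if_false]
  have hoff : ∀ (a a' a'' c c' c'' : ℕ), σ.AgreeOff [rLeft, rRight, rOp]
      ((((((σ.set rLeft a).set rRight a').set rOp a'').set rLeft c).set rRight c').set rOp c'') :=
    fun a a' a'' c c' c'' => ⟨fun r hr => by
      simp only [List.mem_cons, List.not_mem_nil, or_false, not_or] at hr
      simp [RAMState.set_reg, hr.1, hr.2.1, hr.2.2], rfl⟩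
  have hoff' : ∀ (a a' a'' : ℕ), σ.AgreeOff [rLeft, rRight, rOp]
      (((σ.set rLeft a).set rRight a').set rOp a'') :=
    fun a a' a'' => ⟨fun r hr => by
      simp only [List.mem_cons, List.not_mem_nil, or_false, not_or] at hr
      simp [RAMState.set_reg, hr.1, hr.2.1, hr.2.2], rfl⟩
  refine ⟨by omega, by omega, by omega, by omega, ?_⟩
  split_ifs with h0 h1
  · refine hQ _ (hoff' _ _ _) ?_ ?_ ?_ <;>
      simp [RAMState.set_reg, Circuit.wireCode, Circuit.opCodeAt, h0]
  · have hv : 0 < p ∧ p ≤ s := by omega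
    have hg := getD_localInput_code C u x y ⟨p - 1, by omega⟩
    simp only [show p - 1 + 1 = p by omega] at hg
    have hl : (localInput C u x y).getD (3 * p) 0 = C.wireCode false p := by
      rw [Circuit.wireCode, dif_pos hv]
      exact hg 0 (by omega)
    have hr : (localInput C u x y).getD (3 * p + 1) 0 = C.wireCode true p := by
      rw [Circuit.wireCode, dif_pos hv]
      exact hg 1 (by omega)
    have ho : (localInput C u x y).getD (3 * p + 2) 0 = C.opCodeAt p := by
      rw [Circuit.opCodeAt, dif_pos hv]
      exact hg 2 (by omega)
    have hl' := C.wireCode_le false p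
    have hr' := C.wireCode_le true p
    have ho' := C.opCodeAt_lt p
    rw [hl, hr, ho]
    refine ⟨by omega, by omega, by omega, by omega, hQ _ (hoff _ _ _ _ _ _) ?_ ?_ ?_⟩ <;>
      simp [RAMState.set_reg]
  · refine ⟨⟨by omega, by omega⟩, hQ _ (hoff' _ _ _) ?_ ?_ ?_⟩ <;>
      simp [RAMState.set_reg, Circuit.wireCode, Circuit.opCodeAt, show ¬ p ≤ s by omega]

/-- The registers of `σ` describe the node `v`. -/
def RAMState.Encodes (σ : RAMState 17) : TreeNode → Prop
  | .block m => σ.reg rKind = 0 ∧ σ.reg rBlock = m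
  | .wires t m k =>
      σ.reg rKind = 1 ∧ σ.reg rSide = t.toNat ∧ σ.reg rBlock = m ∧ σ.reg rBelow = k

theorem RAMState.Encodes.congr {σ τ : RAMState 17} {v : TreeNode} {L : List (Fin 17)}
    (h : σ.Encodes v) (hτ : ∀ r, r ∉ L → τ.reg r = σ.reg r)
    (hL : rKind ∉ L ∧ rSide ∉ L ∧ rBlock ∉ L ∧ rBelow ∉ L) :
    τ.Encodes v := by
  cases v
  · exact ⟨(hτ _ hL.1).trans h.1, (hτ _ hL.2.2.1).trans h.2⟩
  · exact ⟨(hτ _ hL.1).trans h.1, (hτ _ hL.2.1).trans h.2.1, (hτ _ hL.2.2.1).trans h.2.2.1,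
      (hτ _ hL.2.2.2).trans h.2.2.2⟩

/-- All block numbers that occur in the description of a node are at most `M`. -/
def TreeNode.Within (M : ℕ) : TreeNode → Prop
  | .block m => m ≤ M
  | .wires _ m k => m ≤ M ∧ k ≤ M

theorem TreeNode.Within.child {M : ℕ} {v : TreeNode} (h : v.Within M) (d : Fin 2) :
    (v.child d).Within M := by
  rcases v with m | ⟨t, m, _ | k⟩
  · exact ⟨h, h⟩
  · exact h
  · obtain ⟨h1, h2⟩ := h
    simp only [TreeNode.child]
    split_ifs
    · exact (Nat.le_succ k).trans h2
    · exact ⟨h1, (Nat.le_succ k).trans h2⟩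

/-- Compute the bit of a block at position `rPos`, and add it to the digits in `rAcc`. Here `rPtr`
is the index of the corresponding bit of `x` in the input array. -/
def blockCmd : RAMCmd 17 :=
  resolveCmd rLeft &rPtr ;; resolveCmd rRight (&rPtr + &rWidth) ;;
  rShift ≔ 2 * &rLeft + &rRight ;; rBit ≔ &rOp ;; bitCmd ;;
  rAcc ≔ &rAcc + &rPow * &rBit ;; rPow ≔ &rPow * 2

theorem wp_blockCmd {s b : ℕ} (C : Circuit s) (u : List (Fin 2)) (x y : Fin b → Bool) {B : ℕ}
    {Q : RAMState 17 → Prop} {σ : RAMState 17} {m i : ℕ} (hi : i < b) (hB : 16 < B)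
    (hs : 64 * s < B) (hbs : b ≤ s) (hu : u.length ≤ 2 * s) (hmb : m * b ≤ s)
    (hpow : 2 ^ b < B) (hW : σ.reg rWidth = b)
    (hptr : σ.reg rPtr = 3 + 3 * s + u.length + i) (hm : σ.reg rBlock = m)
    (hacc : σ.reg rAcc = C.blockAcc b m (padBits x) (padBits y) i) (hpw : σ.reg rPow = 2 ^ i)
    (hl : σ.reg rLeft = C.wireCode false (m * b + i))
    (hr : σ.reg rRight = C.wireCode true (m * b + i))
    (ho : σ.reg rOp = C.opCodeAt (m * b + i))
    (hQ : ∀ τ, σ.AgreeOff [rLeft, rRight, rShift, rBit, rAcc, rPow] τ →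
      τ.reg rAcc = C.blockAcc b m (padBits x) (padBits y) (i + 1) → τ.reg rPow = 2 ^ (i + 1) →
      τ.reg rBit = (C.blockBit b m (padBits x) (padBits y)
        (C.blockAcc b m (padBits x) (padBits y) i) i).toNat → Q τ) :
    blockCmd.wp (localInput C u x y) B Q σ := by
  have hm' : m ≤ m * b := Nat.le_mul_of_pos_right m (by omega)
  have hl' := C.wireCode_le false (m * b + i)
  have hr' := C.wireCode_le true (m * b + i)
  have ho' := C.opCodeAt_lt (m * b + i)
  have hacc' := C.blockAcc_lt b m (padBits x) (padBits y) (i + 1)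
  have hacc'' := C.blockAcc_lt b m (padBits x) (padBits y) i
  have hpow' : 2 ^ (i + 1) ≤ 2 ^ b := Nat.pow_le_pow_right (by omega) hi
  have hpow'' : 2 ^ (i + 1) = 2 ^ i * 2 := pow_succ 2 i
  have hx := getD_localInput_left C u x y i hi
  have hy := getD_localInput_right C u x y i
  -- so that the new bit is expressed through the codes that the program has fetched
  rw [Circuit.blockAcc] at hacc' hQ
  rw [C.blockBit_eq_testBit b m _ _ _ i] at hacc' hQ
  generalize C.blockAcc b m (padBits x) (padBits y) i = acc at *
  rw [blockCmd, RAMCmd.wp_seq]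
  refine wp_resolveCmd (acc := acc) (ext := padBits x i) (by omega) (by omega) hW hm hacc (by omega)
    (by omega) (by omega) (by omega) ?_ ?_ fun τ hτ hτl => ?_
  · rw [RAMExp.bounded_var]; omega
  · rw [RAMExp.eval_var, hptr, hx]
  rw [RAMCmd.wp_seq]
  rw [hl] at hτl
  have h1 := hτ.1 rRight (by simp)
  have h2 := hτ.1 rWidth (by simp)
  have h3 := hτ.1 rBlock (by simp)
  have h4 := hτ.1 rAcc (by simp)
  have h5 := hτ.1 rPtr (by simp)
  have h6 := hτ.1 rOp (by simp)
  have h7 := hτ.1 rPow (by simp)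
  refine wp_resolveCmd (acc := acc) (ext := padBits y i) (b := b) (m := m) (by omega) (by omega)
    (by omega) (by omega) (by omega) (by omega)
    (by omega) (by omega) (by omega) ?_ ?_ fun υ hυ hυr => ?_
  · rw [RAMExp.bounded_add, RAMExp.bounded_var, RAMExp.bounded_var, RAMExp.eval_var,
      RAMExp.eval_var]
    omega
  · rw [RAMExp.eval_add, RAMExp.eval_var, RAMExp.eval_var, h2, h5, hptr, hW, ← hy]
    congr 1
    omega
  rw [h1, hr] at hυr
  have k1 := hυ.1 rLeft (by simp)
  have k4 := hυ.1 rAcc (by simp)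
  have k6 := hυ.1 rOp (by simp)
  have k7 := hυ.1 rPow (by simp)
  rw [hτl] at k1
  have hlb := Bool.toNat_le (wireBit b m acc (padBits x i) (C.wireCode false (m * b + i)))
  have hrb := Bool.toNat_le (wireBit b m acc (padBits y i) (C.wireCode true (m * b + i)))
  simp only [RAMCmd.wp_seq, RAMCmd.wp_assign,
    RAMExp.eval_var, RAMExp.eval_ofNat, RAMExp.eval_mul, RAMExp.eval_add,
    RAMExp.bounded_var, RAMExp.bounded_ofNat,
    RAMExp.bounded_add, RAMExp.bounded_mul, RAMState.set_reg, k1, hυr,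
    Fin.isValue, Fin.reduceEq, if_false]
  refine ⟨⟨⟨by omega, by omega, by omega⟩, by omega, by omega⟩, by omega,
    wp_bitCmd (by omega) ?_ ?_ fun φ hφ hφb => ?_⟩
  · simp [RAMState.set_reg]; omega
  · simp [RAMState.set_reg]; omega
  have l4 := hφ.1 rAcc (by simp)
  have l7 := hφ.1 rPow (by simp)
  simp only [RAMState.set_reg, Fin.isValue, Fin.reduceEq, if_true, if_false] at hφb l4 l7
  rw [k6, h6, ho] at hφb
  rw [← hφb] at hacc' hQ
  have hbit : φ.reg rBit ≤ 1 := hφb ▸ Bool.toNat_le _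
  have l4' : φ.reg rAcc = acc := by omega
  have l7' : φ.reg rPow = 2 ^ i := by omega
  have hmul : 2 ^ i * φ.reg rBit ≤ 2 ^ i * 1 := Nat.mul_le_mul_left _ hbit
  simp only [RAMCmd.wp_seq, RAMCmd.wp_assign,
    RAMExp.eval_var, RAMExp.eval_ofNat, RAMExp.eval_mul, RAMExp.eval_add,
    RAMExp.bounded_var, RAMExp.bounded_ofNat,
    RAMExp.bounded_add, RAMExp.bounded_mul, RAMState.set_reg, l4', l7',
    Fin.isValue, Fin.reduceEq, if_false]
  refine ⟨by omega, by omega, hQ _ ⟨fun r hr => ?_, ?_⟩ ?_ ?_ ?_⟩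
  · simp only [List.mem_cons, List.not_mem_nil, or_false, not_or] at hr
    obtain ⟨r1, r2, r3, r4, r5, r6⟩ := hr
    rw [RAMState.set_reg, if_neg r6, RAMState.set_reg, if_neg r5, hφ.1 r (by simp [*]),
      RAMState.set_reg, if_neg r4, RAMState.set_reg, if_neg r3, hυ.1 r (by simp [*]),
      hτ.1 r (by simp [*])]
  · exact hφ.2.trans (hυ.2.trans hτ.2)
  · simp [RAMState.set_reg]
  · simp [RAMState.set_reg, hpow'']
  · simp [RAMState.set_reg]

/-- Compute bit number `rWidth - rCount` of the value of a node of the form `wires`. Here `rPtr` is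
the index of the corresponding bit of `x` in the input array, so that `y` starts at the index
`rPtr + rCount`. -/
def wiresCmd : RAMCmd 17 :=
  .ifz &rBelow (rBit ≔ 0)
    (.ifz &rSide .skip (rLeft ≔ &rRight) ;;
      rTmp ≔ (&rBelow - 1) * &rWidth ;;
      .ifz (&rTmp - (&rLeft - 1))
        (rBit ≔ .read (&rPtr + &rCount + (&rLeft - 1 - &rTmp)))
        (rBit ≔ .read &rPtr))

theorem wp_wiresCmd {s b : ℕ} (C : Circuit s) (u : List (Fin 2)) (x y : Fin b → Bool) {B : ℕ}
    {Q : RAMState 17 → Prop} {σ : RAMState 17} {t : Bool} {m k : ℕ} (i : Fin b) (hB : 16 < B)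
    (hs : 64 * s < B) (hbs : b ≤ s) (hu : u.length ≤ 2 * s) (hkb : k * b ≤ s)
    (hW : σ.reg rWidth = b) (hcount : σ.reg rCount = b - i)
    (hptr : σ.reg rPtr = 3 + 3 * s + u.length + i) (ht : σ.reg rSide = t.toNat)
    (hk : σ.reg rBelow = k) (hl : σ.reg rLeft = C.wireCode false (m * b + i))
    (hr : σ.reg rRight = C.wireCode true (m * b + i))
    (hQ : ∀ τ, σ.AgreeOff [rLeft, rTmp, rBit] τ →
      τ.reg rBit = (C.nodeFn (.wires t m k) x y i).toNat → Q τ) :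
    wiresCmd.wp (localInput C u x y) B Q σ := by
  have hi := i.isLt
  have hl' := C.wireCode_le false (m * b + i)
  have hr' := C.wireCode_le true (m * b + i)
  have htB := Bool.toNat_le t
  rw [wiresCmd, RAMCmd.wp_ifz, RAMExp.eval_var, RAMExp.bounded_var]
  have hkB : k ≤ k * b := Nat.le_mul_of_pos_right k (by omega)
  refine ⟨by omega, ?_⟩
  rcases k with _ | k
  · rw [if_pos hk, RAMCmd.wp_assign, RAMExp.bounded_ofNat]
    refine ⟨by omega, hQ _ ⟨fun r hr => ?_, rfl⟩ ?_⟩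
    · simp only [List.mem_cons, List.not_mem_nil, or_false, not_or] at hr
      rw [RAMState.set_reg, if_neg hr.2.2]
    · simp [RAMState.set_reg, Circuit.nodeFn, RAMExp.eval_ofNat]
  rw [if_neg (by omega), RAMCmd.wp_seq]
  rw [add_mul, one_mul] at hkb hkB
  have hx := getD_localInput_left C u x y i hi
  have hy := getD_localInput_right C u x y
  -- the part of the program that follows the choice of the wire
  have rest : ∀ τ : RAMState 17, σ.AgreeOff [rLeft, rTmp, rBit] τ →
      τ.reg rLeft = C.wireCode t (m * b + i) →
      (rTmp ≔ (&rBelow - 1) * &rWidth ;;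
        .ifz (&rTmp - (&rLeft - 1))
          (rBit ≔ .read (&rPtr + &rCount + (&rLeft - 1 - &rTmp)))
          (rBit ≔ .read &rPtr) : RAMCmd 17).wp (localInput C u x y) B Q τ := by
    intro τ hτ hτl
    have hc := C.wireCode_le t (m * b + i)
    have h1 := hτ.1 rBelow (by simp)
    have h2 := hτ.1 rWidth (by simp)
    have h3 := hτ.1 rPtr (by simp)
    have h4 := hτ.1 rCount (by simp)
    have hoff : ∀ a c : ℕ, σ.AgreeOff [rLeft, rTmp, rBit] ((τ.set rTmp a).set rBit c) :=
      fun a c => ⟨fun r hr => by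
        rw [← hτ.1 r hr]
        simp only [List.mem_cons, List.not_mem_nil, or_false, not_or] at hr
        rw [RAMState.set_reg, if_neg hr.2.2, RAMState.set_reg, if_neg hr.2.1], hτ.2⟩
    rw [hk] at h1
    rw [hW] at h2
    rw [hptr] at h3
    rw [hcount] at h4
    simp only [RAMCmd.wp_seq, RAMCmd.wp_assign, RAMCmd.wp_ifz,
      RAMExp.eval_var, RAMExp.eval_ofNat, RAMExp.eval_sub, RAMExp.eval_mul, RAMExp.eval_add,
      RAMExp.eval_read, RAMExp.bounded_var, RAMExp.bounded_ofNat, RAMExp.bounded_sub,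
      RAMExp.bounded_add, RAMExp.bounded_mul, RAMExp.bounded_read, RAMState.set_reg, h1, h2, h3,
      h4, hτl, Fin.isValue, Fin.reduceEq, if_true, if_false, Nat.add_sub_cancel]
    refine ⟨⟨⟨by omega, by omega⟩, by omega, by omega⟩, ⟨by omega, by omega, by omega⟩, ?_⟩
    have hpos := C.wirePos_eq_wireCode t (m * b + i)
    split_ifs with h
    · have hle : k * b ≤ C.wireCode t (m * b + i) - 1 := by omega
      rw [show 3 + 3 * s + u.length + i + (b - i) + (C.wireCode t (m * b + i) - 1 - k * b) =
        3 + 3 * s + u.length + b + (C.wireCode t (m * b + i) - 1 - k * b) by omega, hy]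
      have hbit := Bool.toNat_le (padBits y (C.wireCode t (m * b + i) - 1 - k * b))
      refine ⟨⟨⟨⟨by omega, by omega, by omega⟩, ⟨⟨by omega, by omega⟩, by omega⟩, by omega⟩,
        by omega⟩, hQ _ (hoff _ _) ?_⟩
      simp [RAMState.set_reg, Circuit.nodeFn, hpos, hle]
    · have hle : ¬ k * b ≤ C.wireCode t (m * b + i) - 1 := by omega
      rw [hx]
      have hbit := Bool.toNat_le (padBits x i)
      refine ⟨⟨by omega, by omega⟩, hQ _ (hoff _ _) ?_⟩
      simp [RAMState.set_reg, Circuit.nodeFn, hpos, hle, padBits]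
  rw [RAMCmd.wp_ifz, RAMExp.eval_var, RAMExp.bounded_var, ht]
  refine ⟨by omega, ?_⟩
  cases t with
  | false => exact rest σ ⟨fun _ _ => rfl, rfl⟩ hl
  | true =>
    simp only [Bool.toNat_true, one_ne_zero, if_false, RAMCmd.wp_assign, RAMExp.bounded_var,
      RAMExp.eval_var]
    refine ⟨by omega, rest _ ⟨fun r hr => ?_, rfl⟩ ?_⟩
    · simp only [List.mem_cons, List.not_mem_nil, or_false, not_or] at hr
      rw [RAMState.set_reg, if_neg hr.1]
    · rw [RAMState.set_reg, if_pos rfl, hr]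

/-! ### The program for a node of the tree -/

/-- Move from a node to its child number `rTmp`. -/
def childCmd : RAMCmd 17 :=
  .ifz &rKind
    (rKind ≔ 1 ;; rSide ≔ &rTmp ;; rBelow ≔ &rBlock)
    (.ifz &rBelow .skip
      (rBelow ≔ &rBelow - 1 ;; .ifz &rTmp .skip (rKind ≔ 0 ;; rBlock ≔ &rBelow)))

theorem wp_childCmd {I : List ℕ} {B : ℕ} {Q : RAMState 17 → Prop} {σ : RAMState 17}
    {v : TreeNode} {d : Fin 2} {M : ℕ} (hv : σ.Encodes v) (hM : v.Within M) (hMB : M < B)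
    (hB : 2 < B) (hd : σ.reg rTmp = d)
    (hQ : ∀ τ, σ.AgreeOff [rKind, rSide, rBlock, rBelow] τ → τ.Encodes (v.child d) → Q τ) :
    childCmd.wp I B Q σ := by
  have hoff : ∀ τ : RAMState 17, τ.out = σ.out →
      (∀ r, r ≠ rKind → r ≠ rSide → r ≠ rBlock → r ≠ rBelow → τ.reg r = σ.reg r) →
      σ.AgreeOff [rKind, rSide, rBlock, rBelow] τ := fun τ ho h => ⟨fun r hr => by
    simp only [List.mem_cons, List.not_mem_nil, or_false, not_or] at hr
    exact h r hr.1 hr.2.1 hr.2.2.1 hr.2.2.2, ho⟩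
  have hd2 := d.isLt
  simp only [childCmd, RAMCmd.wp_seq, RAMCmd.wp_assign, RAMCmd.wp_ifz, RAMCmd.wp_skip,
    RAMExp.eval_var, RAMExp.eval_ofNat, RAMExp.eval_sub, RAMExp.bounded_var,
    RAMExp.bounded_ofNat, RAMExp.bounded_sub, RAMState.set_reg, hd,
    Fin.isValue, Fin.reduceEq, if_true, if_false]
  rcases v with m | ⟨t, m, _ | k⟩
  · obtain ⟨h1, h2⟩ := hv
    have hm : m ≤ M := hM
    simp only [h1, h2, if_true]
    refine ⟨by omega, by omega, by omega, by omega, hQ _ (hoff _ rfl fun r r1 r2 r3 r4 => ?_) ?_⟩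
    · simp [RAMState.set_reg, r1, r2, r4]
    · refine ⟨?_, ?_, ?_, ?_⟩
      · simp [RAMState.set_reg]
      · fin_cases d <;> simp [RAMState.set_reg]
      · simp [RAMState.set_reg, h2]
      · simp [RAMState.set_reg]
  · obtain ⟨h1, h2, h3, h4⟩ := id hv
    simp only [h1, h4, if_true, one_ne_zero, if_false]
    exact ⟨by omega, by omega, hQ _ (hoff _ rfl fun _ _ _ _ _ => rfl) hv⟩
  · obtain ⟨h1, h2, h3, h4⟩ := hv
    have hm : m ≤ M ∧ k + 1 ≤ M := hM
    simp only [h1, h4, one_ne_zero, if_false, Nat.add_eq_zero_iff, and_false, Nat.add_sub_cancel]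
    refine ⟨by omega, by omega, by omega, by omega, ?_⟩
    obtain rfl | rfl : d = 0 ∨ d = 1 := by omega
    · simp only [Fin.isValue, Fin.val_zero, if_true]
      refine hQ _ (hoff _ rfl fun r r1 r2 r3 r4 => ?_) ⟨?_, ?_, ?_, ?_⟩
      · simp [RAMState.set_reg, r4]
      all_goals simp [RAMState.set_reg, *]
    · simp only [Fin.isValue, Fin.val_one, one_ne_zero, if_false]
      refine ⟨by omega, by omega, hQ _ (hoff _ rfl fun r r1 r2 r3 r4 => ?_) ⟨?_, ?_⟩⟩
      · simp [RAMState.set_reg, r1, r3, r4]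
      all_goals simp [RAMState.set_reg]

/-- Follow a path of `rCount` steps, which is found in the input array from index `rPtr` on. -/
def walkCmd : RAMCmd 17 :=
  .loop &rCount
    (rTmp ≔ .read &rPtr ;; rPtr ≔ &rPtr + 1 ;; rCount ≔ &rCount - 1 ;; childCmd)

theorem within_nodeAt (s b : ℕ) (u : List (Fin 2)) : (Circuit.nodeAt s b u).Within (s / b) := by
  induction u using List.reverseRecOn with
  | nil => exact le_refl (s / b)
  | append_singleton u d ih =>
    have := ih.child d
    simpa only [Circuit.nodeAt, List.foldl_append, List.foldl_cons, List.foldl_nil] using this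

theorem wp_walkCmd {s b : ℕ} (C : Circuit s) (u : List (Fin 2)) (x y : Fin b → Bool) {B : ℕ}
    {Q : RAMState 17 → Prop} {σ : RAMState 17} (hB : 2 < B)
    (hs : 64 * s < B) (hu : u.length ≤ 2 * s) (hcount : σ.reg rCount = u.length)
    (hptr : σ.reg rPtr = 3 + 3 * s) (hv : σ.Encodes (.block (s / b)))
    (hQ : ∀ τ, σ.AgreeOff [rKind, rSide, rBlock, rBelow, rTmp, rPtr, rCount] τ →
      τ.reg rPtr = 3 + 3 * s + u.length → τ.Encodes (Circuit.nodeAt s b u) → Q τ) :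
    walkCmd.wp (localInput C u x y) B Q σ := by
  have hsb : s / b ≤ s := Nat.div_le_self s b
  refine RAMCmd.wp_loop (fun k τ => τ.reg rCount = k ∧ k ≤ u.length ∧
    τ.reg rPtr = 3 + 3 * s + (u.length - k) ∧
    τ.Encodes (Circuit.nodeAt s b (u.take (u.length - k))) ∧
    σ.AgreeOff [rKind, rSide, rBlock, rBelow, rTmp, rPtr, rCount] τ) ?_ ?_ ?_ u.length σ
    ⟨hcount, le_rfl, by omega, by simpa [Circuit.nodeAt] using hv, fun _ _ => rfl, rfl⟩
  · rintro k τ ⟨h1, h2, -⟩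
    rw [RAMExp.bounded_var]
    omega
  · rintro τ ⟨h1, -, h2, h3, h4⟩
    refine ⟨h1, hQ τ h4 h2 ?_⟩
    simpa using h3
  · rintro k τ ⟨h1, h2, h3, h4, h5⟩
    refine ⟨by rw [RAMExp.eval_var, h1]; omega, ?_⟩
    have hlt : u.length - (k + 1) < u.length := by omega
    have hr := getD_localInput_node C u x y _ hlt
    have hd := (u[u.length - (k + 1)]).isLt
    simp only [RAMCmd.wp_seq, RAMCmd.wp_assign, RAMExp.eval_var, RAMExp.eval_ofNat,
      RAMExp.eval_sub, RAMExp.eval_add, RAMExp.eval_read, RAMExp.bounded_var,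
      RAMExp.bounded_ofNat, RAMExp.bounded_sub, RAMExp.bounded_add, RAMExp.bounded_read,
      RAMState.set_reg, h1, h3, hr, Fin.isValue, Fin.reduceEq, if_false]
    refine ⟨by omega, by omega, by omega, ?_⟩
    refine wp_childCmd (v := Circuit.nodeAt s b (u.take (u.length - (k + 1))))
      (d := u[u.length - (k + 1)]) (M := s / b)
      (h4.congr (L := [rTmp, rPtr, rCount]) (fun r hr => ?_) (by simp))
      (within_nodeAt s b _) (by omega) hB ?_ ?_
    · simp only [List.mem_cons, List.not_mem_nil, or_false, not_or] at hr
      simp [RAMState.set_reg, hr.1, hr.2.1, hr.2.2]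
    · simp [RAMState.set_reg]
    · intro υ hυ hυv
      refine ⟨?_, by omega, ?_, ?_, fun r hr => ?_, ?_⟩
      · rw [hυ.1 rCount (by simp)]
        simp [RAMState.set_reg]
      · rw [hυ.1 rPtr (by simp)]
        simp only [RAMState.set_reg, Fin.isValue, Fin.reduceEq, if_false, if_true]
        omega
      · rw [show u.length - k = u.length - (k + 1) + 1 by omega,
          List.take_succ_eq_append_getElem hlt]
        simpa only [Circuit.nodeAt, List.foldl_append, List.foldl_cons, List.foldl_nil] using hυv
      · simp only [List.mem_cons, List.not_mem_nil, or_false, not_or] at hr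
        obtain ⟨r1, r2, r3, r4, r5, r6, r7⟩ := hr
        rw [hυ.1 r (by simp [*]), ← h5.1 r (by simp [*])]
        simp [RAMState.set_reg, *]
      · exact hυ.2.trans h5.2

/-- The number of the block of which a node provides the values or the wires. -/
def TreeNode.index : TreeNode → ℕ
  | .block m => m
  | .wires _ m _ => m

/-- Write the next bit of the value of a node. -/
def emitCmd : RAMCmd 17 :=
  fetchCmd ;; .ifz &rKind blockCmd wiresCmd ;; .write &rBit ;;
  rPos ≔ &rPos + 1 ;; rPtr ≔ &rPtr + 1 ;; rCount ≔ &rCount - 1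

/-- The state of the computation before bit number `i` of the value of the node `v` is written. -/
structure EmitInv {s b : ℕ} (C : Circuit s) (u : List (Fin 2)) (x y : Fin b → Bool) (v : TreeNode)
    (i : ℕ) (σ : RAMState 17) : Prop where
  le : i ≤ b
  size : σ.reg rSize = s
  width : σ.reg rWidth = b
  count : σ.reg rCount = b - i
  ptr : σ.reg rPtr = 3 + 3 * s + u.length + i
  pos : σ.reg rPos = v.index * b + i
  node : σ.Encodes v
  acc : ∀ m, v = .block m →
    σ.reg rAcc = C.blockAcc b m (padBits x) (padBits y) i ∧ σ.reg rPow = 2 ^ i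
  out : σ.out = (bitList (C.nodeFn v x y)).take i

theorem EmitInv.wp_emitCmd {s b : ℕ} {C : Circuit s} {u : List (Fin 2)} {x y : Fin b → Bool}
    {v : TreeNode} {i : ℕ} {σ : RAMState 17} {B : ℕ} (h : EmitInv C u x y v i σ)
    (hi : i < b) (hB : 16 < B) (hs : 64 * s < B) (hbs : b ≤ s) (hu : u.length ≤ 2 * s)
    (hv : v.Within (s / b)) (hpow : 2 ^ b < B) :
    emitCmd.wp (localInput C u x y) B (EmitInv C u x y v (i + 1)) σ := by
  obtain ⟨-, h0, h1, h2, h3, h9, hn, hacc, hout⟩ := h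
  have hdiv := Nat.div_mul_le_self s b
  have hidx : v.index ≤ s / b := by
    cases v
    · exact hv
    · exact hv.1
  have hidxb : v.index * b ≤ s := (Nat.mul_le_mul_right b hidx).trans hdiv
  have hlen : (bitList (C.nodeFn v x y)).length = b := by simp [bitList]
  have hget : (bitList (C.nodeFn v x y))[i]'(by omega) = (C.nodeFn v x y ⟨i, hi⟩).toNat := by
    simp [bitList]
  -- what remains to be done once the bit is known
  have rest : ∀ τ : RAMState 17,
      σ.AgreeOff [rLeft, rRight, rOp, rShift, rBit, rAcc, rPow, rTmp] τ →
      (∀ m, v = .block m → τ.reg rAcc = C.blockAcc b m (padBits x) (padBits y) (i + 1) ∧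
        τ.reg rPow = 2 ^ (i + 1)) →
      τ.reg rBit = (C.nodeFn v x y ⟨i, hi⟩).toNat →
      (.write &rBit ;; rPos ≔ &rPos + 1 ;; rPtr ≔ &rPtr + 1 ;; rCount ≔ &rCount - 1 :
        RAMCmd 17).wp (localInput C u x y) B (EmitInv C u x y v (i + 1)) τ := by
    intro τ hτ hτa hbit
    have hbit' := Bool.toNat_le (C.nodeFn v x y ⟨i, hi⟩)
    have k0 := hτ.1 rSize (by simp)
    have k1 := hτ.1 rWidth (by simp)
    have k2 := hτ.1 rCount (by simp)
    have k3 := hτ.1 rPtr (by simp)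
    have k9 := hτ.1 rPos (by simp)
    simp only [RAMCmd.wp_seq, RAMCmd.wp_assign, RAMCmd.wp_write, RAMExp.eval_var,
      RAMExp.eval_ofNat, RAMExp.eval_sub, RAMExp.eval_add, RAMExp.bounded_var,
      RAMExp.bounded_ofNat, RAMExp.bounded_sub, RAMExp.bounded_add,
      RAMState.set_reg, RAMState.emit_reg, Fin.isValue, Fin.reduceEq, if_false]
    refine ⟨by omega, by omega, by omega, by omega, ⟨by omega, ?_, ?_, ?_, ?_, ?_, ?_, ?_, ?_⟩⟩
    · simp [RAMState.set_reg, RAMState.emit_reg, k0, h0]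
    · simp [RAMState.set_reg, RAMState.emit_reg, k1, h1]
    · simp only [RAMState.set_reg, if_true]; omega
    · simp only [RAMState.set_reg, Fin.isValue, Fin.reduceEq, if_true, if_false]; omega
    · simp only [RAMState.set_reg, Fin.isValue, Fin.reduceEq, if_true, if_false]; omega
    · refine (hn.congr hτ.1 (by simp)).congr (L := [rPos, rPtr, rCount]) (fun r hr => ?_) (by simp)
      simp only [List.mem_cons, List.not_mem_nil, or_false, not_or] at hr
      simp [RAMState.set_reg, RAMState.emit_reg, hr.1, hr.2.1, hr.2.2]
    · intro m hm
      simpa [RAMState.set_reg, RAMState.emit_reg] using hτa m hm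
    · rw [List.take_succ_eq_append_getElem (by omega), hget, ← hout, ← hbit, ← hτ.2]
      rfl
  rw [emitCmd, RAMCmd.wp_seq]
  refine wp_fetchCmd C u x y hB (by omega) h0 h9 (by omega) fun τ hτ hl hr ho => ?_
  have k1 := hτ.1 rWidth (by simp)
  have k2 := hτ.1 rCount (by simp)
  have k3 := hτ.1 rPtr (by simp)
  rw [RAMCmd.wp_seq, RAMCmd.wp_ifz, RAMExp.eval_var, RAMExp.bounded_var]
  have hn' := hn.congr hτ.1 (by simp)
  rcases v with m | ⟨t, m, k⟩
  · obtain ⟨n1, n2⟩ := hn'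
    obtain ⟨a1, a2⟩ := hacc m rfl
    refine ⟨by omega, ?_⟩
    rw [if_pos n1]
    refine wp_blockCmd C u x y hi hB hs hbs hu hidxb hpow (k1.trans h1) (k3.trans h3) n2
      ((hτ.1 rAcc (by simp)).trans a1) ((hτ.1 rPow (by simp)).trans a2) hl hr ho
      fun υ hυ b1 b2 b3 => rest υ ⟨fun r hr => ?_, hυ.2.trans hτ.2⟩ ?_ b3
    · simp only [List.mem_cons, List.not_mem_nil, or_false, not_or] at hr
      obtain ⟨r1, r2, r3, r4, r5, r6, r7, r8⟩ := hr
      rw [hυ.1 r (by simp [*]), hτ.1 r (by simp [*])]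
    · rintro m' ⟨⟩
      exact ⟨b1, b2⟩
  · obtain ⟨n1, n2, n3, n4⟩ := hn'
    refine ⟨by omega, ?_⟩
    rw [if_neg (by omega)]
    refine wp_wiresCmd C u x y ⟨i, hi⟩ hB hs hbs hu ((Nat.mul_le_mul_right b hv.2).trans hdiv)
      (k1.trans h1) (k2.trans h2) (k3.trans h3) n2 n4 hl hr
      fun υ hυ b3 => rest υ ⟨fun r hr => ?_, hυ.2.trans hτ.2⟩ ?_ b3
    · simp only [List.mem_cons, List.not_mem_nil, or_false, not_or] at hr
      obtain ⟨r1, r2, r3, r4, r5, r6, r7, r8⟩ := hr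
      rw [hυ.1 r (by simp [*]), hτ.1 r (by simp [*])]
    · rintro m' ⟨⟩

/-- Compute the function at a node of the tree. -/
def nodeCmd : RAMCmd 17 :=
  rSize ≔ .read 0 ;; rWidth ≔ .read 1 ;; rCount ≔ .read 2 ;;
  rBlock ≔ &rSize / &rWidth ;; rPtr ≔ 3 + 3 * &rSize ;;
  walkCmd ;;
  rPos ≔ &rBlock * &rWidth ;; rCount ≔ &rWidth ;; rPow ≔ 1 ;;
  .loop &rCount emitCmd

theorem wp_nodeCmd {s b : ℕ} (C : Circuit s) (u : List (Fin 2)) (x y : Fin b → Bool) {B : ℕ}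
    (hB : 16 < B) (hs : 64 * s < B) (hb : 0 < b) (hbs : b ≤ s) (hu : u.length ≤ 2 * s)
    (hpow : 2 ^ b < B) :
    nodeCmd.wp (localInput C u x y) B
      (fun σ => σ.out = bitList (C.nodeFn (Circuit.nodeAt s b u) x y)) ⟨fun _ => 0, []⟩ := by
  have i0 : (localInput C u x y).getD 0 0 = s := rfl
  have i1 : (localInput C u x y).getD 1 0 = b := rfl
  have i2 : (localInput C u x y).getD 2 0 = u.length := rfl
  have hlen : (bitList (C.nodeFn (Circuit.nodeAt s b u) x y)).length = b := by simp [bitList]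
  simp only [nodeCmd, RAMCmd.wp_seq, RAMCmd.wp_assign, RAMExp.eval_var, RAMExp.eval_ofNat,
    RAMExp.eval_add, RAMExp.eval_mul, RAMExp.eval_div, RAMExp.eval_read, RAMExp.bounded_var,
    RAMExp.bounded_ofNat, RAMExp.bounded_add, RAMExp.bounded_mul, RAMExp.bounded_div,
    RAMExp.bounded_read, RAMState.set_reg, i0, i1, i2, Fin.isValue, Fin.reduceEq, if_true,
    if_false]
  refine ⟨by omega, by omega, by omega, by omega, by omega, ?_⟩
  refine wp_walkCmd C u x y (by omega) hs hu ?_ ?_ ⟨?_, ?_⟩ fun τ hτ hptr hn => ?_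
  · simp [RAMState.set_reg]
  · simp [RAMState.set_reg]
  · simp [RAMState.set_reg]
  · simp [RAMState.set_reg]
  have k0 := hτ.1 rSize (by simp)
  have k1 := hτ.1 rWidth (by simp)
  have k10 := hτ.1 rAcc (by simp)
  have ko := hτ.2
  simp only [RAMState.set_reg, RAMState.set_out, Fin.isValue, Fin.reduceEq, if_true, if_false]
    at k0 k1 k10 ko
  have hv := within_nodeAt s b u
  generalize Circuit.nodeAt s b u = v at *
  have hdiv := Nat.div_mul_le_self s b
  have hidx : v.index ≤ s / b := by
    cases v
    · exact hv
    · exact hv.1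
  have hidxb : v.index * b ≤ s := (Nat.mul_le_mul_right b hidx).trans hdiv
  have hidx' : v.index ≤ v.index * b := Nat.le_mul_of_pos_right _ hb
  have k6 : τ.reg rBlock = v.index := by
    cases v
    · exact hn.2
    · exact hn.2.2.1
  simp only [RAMCmd.wp_seq, RAMCmd.wp_assign, RAMExp.eval_var, RAMExp.eval_ofNat,
    RAMExp.eval_mul, RAMExp.bounded_var, RAMExp.bounded_ofNat, RAMExp.bounded_mul,
    RAMState.set_reg, k1, k6, Fin.isValue, Fin.reduceEq, if_false]
  refine ⟨by omega, by omega, by omega, ?_⟩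
  refine RAMCmd.wp_loop (fun j σ => j ≤ b ∧ EmitInv C u x y v (b - j) σ) ?_ ?_ ?_ b _ ⟨le_rfl, ?_⟩
  · rintro j σ ⟨hj, h⟩
    have := h.count
    rw [RAMExp.bounded_var]
    omega
  · rintro σ ⟨-, h⟩
    refine ⟨by rw [RAMExp.eval_var, h.count]; omega, ?_⟩
    rw [h.out, List.take_of_length_le (by omega)]
  · rintro j σ ⟨hj, h⟩
    refine ⟨by rw [RAMExp.eval_var, h.count]; omega, ?_⟩
    refine RAMCmd.wp_mono _ (fun τ hτ => ?_) _
      (h.wp_emitCmd (by omega) hB hs hbs hu hv hpow)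
    rw [show b - (j + 1) + 1 = b - j by omega] at hτ
    exact ⟨by omega, hτ⟩
  · rw [Nat.sub_self]
    refine ⟨Nat.zero_le _, ?_, ?_, ?_, ?_, ?_, ?_, fun m _ => ?_, ?_⟩
    · simp [RAMState.set_reg, k0]
    · simp [RAMState.set_reg, k1]
    · simp [RAMState.set_reg]
    · simp [RAMState.set_reg, hptr]
    · simp [RAMState.set_reg]
    · refine hn.congr (L := [rPos, rCount, rPow]) (fun r hr => ?_) (by simp)
      simp only [List.mem_cons, List.not_mem_nil, or_false, not_or] at hr
      simp [RAMState.set_reg, hr.1, hr.2.1, hr.2.2]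
    · simp [RAMState.set_reg, k10, Circuit.blockAcc]
    · simp [RAMState.set_out, ko]

/-! ### The reduction -/

/-- Compute the height of the tree. -/
def heightCmd : RAMCmd 0 := .write (2 * (.read 0 / .read 1) + 1)

theorem wp_heightCmd {s b B : ℕ} (hB : 16 < B) (hs : 64 * s < B) (hbs : b ≤ s) :
    heightCmd.wp [s, b] B (fun σ => σ.out = [2 * (s / b) + 1]) ⟨fun _ => 0, []⟩ := by
  have i0 : [s, b].getD 0 0 = s := rfl
  have i1 : [s, b].getD 1 0 = b := rfl
  have hsb : s / b ≤ s := Nat.div_le_self s b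
  simp only [heightCmd, RAMCmd.wp_write, RAMExp.eval_ofNat,
    RAMExp.eval_add, RAMExp.eval_mul, RAMExp.eval_div, RAMExp.eval_read,
    RAMExp.bounded_ofNat, RAMExp.bounded_add, RAMExp.bounded_mul, RAMExp.bounded_div,
    RAMExp.bounded_read, i0, i1]
  exact ⟨by omega, rfl⟩

theorem mainTheorem2 :
    ∃ (P Q : List RAMInstr) (c₁ c₂ : ℕ), ∀ (s b : ℕ) (hb : 2 ≤ b) (hbs : b ≤ s),
      ∃ h : ℕ, (h : ℝ) ≤ c₁ * ((s : ℝ) / b) ∧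
        RAMComputesInSpace Q [s, b] [h] (c₂ * (b + Nat.log 2 s)) ∧
        ∀ C : Circuit s, ∃ T : TreeEval 2 h b,
          T.rootVal ⟨s % b, Nat.mod_lt s (by omega)⟩ = C.output (by omega) ∧
          ∀ (u : List (Fin 2)) (hu : u.length ≤ h) (x y : Fin b → Bool),
            RAMComputesInSpace P (localInput C u x y) (bitList (T.fn u hu ![x, y]))
              (c₂ * (b + Nat.log 2 s)) := by
  -- `D` bounds the numbers of registers of both programs
  obtain ⟨D, hD⟩ : ∃ D, D = 17 + nodeCmd.temps + heightCmd.temps := ⟨_, rfl⟩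
  refine ⟨nodeCmd.compile 0, heightCmd.compile 0, 3, D * (D + 9), fun s b hb hbs =>
    ⟨2 * (s / b) + 1, ?_, ?_⟩⟩
  · have h1 : ((s / b : ℕ) : ℝ) ≤ (s : ℝ) / b := Nat.cast_div_le
    have h2 : (1 : ℝ) ≤ (s : ℝ) / b := by
      rw [one_le_div (by positivity)]
      exact_mod_cast hbs
    push_cast
    linarith
  have hlog : s < 2 ^ (Nat.log 2 s + 1) := Nat.lt_pow_succ_log_self (by omega) s
  -- all values are less than `2 ^ K` with `K = b + log s + 8`
  have hK : 2 ^ (b + Nat.log 2 s + 8) = 2 ^ b * 2 ^ (Nat.log 2 s + 1) * 128 := by ring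
  have hbpow : 2 ^ 2 ≤ 2 ^ b := Nat.pow_le_pow_right (by omega) hb
  have hs : 64 * s < 2 ^ (b + Nat.log 2 s + 8) := by
    have : 1 * s ≤ 2 ^ b * 2 ^ (Nat.log 2 s + 1) := Nat.mul_le_mul (by omega) hlog.le
    omega
  have hpow : 2 ^ b < 2 ^ (b + Nat.log 2 s + 8) := Nat.pow_lt_pow_right (by omega) (by omega)
  have hB : 16 < 2 ^ (b + Nat.log 2 s + 8) := by omega
  have hspace : ∀ N ≤ D, N * (N + (b + Nat.log 2 s + 8)) ≤ D * (D + 9) * (b + Nat.log 2 s) := by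
    intro N hN
    rw [mul_assoc]
    refine Nat.mul_le_mul hN ?_
    have : (D + 8) * 1 ≤ (D + 8) * (b + Nat.log 2 s) := Nat.mul_le_mul_left _ (by omega)
    rw [show D + 9 = D + 8 + 1 from rfl, add_mul (D + 8) 1]
    omega
  refine ⟨heightCmd.computesInSpace (wp_heightCmd hB hs hbs) (hspace _ (by omega)), fun C =>
    ⟨C.tree b, C.tree_rootVal (by omega) (by omega), fun u hu x y => ?_⟩⟩
  rw [C.tree_fn]
  refine nodeCmd.computesInSpace (wp_nodeCmd C u x y hB hs (by omega) hbs ?_ hpow)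
    (hspace _ (by omega))
  have : s / b ≤ s / 2 := Nat.div_le_div_left hb (by omega)
  omega
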